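/- **Setting.** Let $p,q$ be odd primes with $p\equiv 1 \pmod q$, let $t\in\mathbb N$ satisfy $t^q\equiv 1\pmod p$ and $t\not\equiv 1\pmod p$, and let $\omega\in\mathbb C$ be a primitive $q$-th root of unity. Let $G=\mathbb Z_p\rtimes\mathbb Z_q=\langle a,b\mid a^p=b^q=1,\ bab^{-1}=a^t\rangle$ and $F=\mathbb Z_q=\langle x\mid x^q=1\rangle$, with $F$ acting on $G$ from the right by $g\triangleleft x=bgb^{-1}$. Let $\mathscr A_0=\mathbb C^G\#\mathbb CF$ be the Hopf $*$-algebra with basis $e_g\#f$ ($g\in G$, $f\in F$), unit $\sum_g e_g\#1$, and $$(e_g\#f)(e_h\#f')=\delta_{g\triangleleft f,h}\,e_g\#ff',\qquad \Delta(e_g\#f)=\sum_{g'g''=g}(e_{g'}\#f)\otimes(e_{g''}\#f),$$ $$\epsilon(e_g\#f)=\delta_{g,1},\qquad S(e_g\#f)=e_{(g\triangleleft f)^{-1}}\#f^{-1},\qquad (e_g\#f)^*=e_{g\triangleleft f}\#f^{-1}.$$ Let $\{E_{g;f}\}$ be the basis of $\mathscr A_0^*$ dual to $\{e_g\#f\}$.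 The Drinfel'd double of a finite-dimensional Hopf algebra $H$ is $D(H)=(H^*)^{cop}\otimes H$ as a coalgebra, with product $$(f\otimes h)(g\otimes k)=\sum f\,[h_{(1)}\rightharpoonup g\leftharpoonup S^{-1}(h_{(3)})]\otimes h_{(2)}k,\qquad \langle u\rightharpoonup g\leftharpoonup v,c\rangle=\langle g,vcu\rangle ;$$ one writes $fh$ for $f\otimes h$. Its antipode is $S(fh)=S(h)\,(f\circ S^{-1})$. If $H$ is a Hopf $*$-algebra, the involution of $D(H)$ is $(fh)^*=h^*f^*$, where $f^*(c)=\overline{f(S(c)^*)}$. Let $\chi:\mathscr A_0\to\mathbb C$ be the algebra map with $\chi(e_g\#1)=\delta_{g,b}$ and $\chi(1\#x)=\omega$, and let $I=D(\mathscr A_0)\langle\chi x\rangle^+$ be the left ideal generated by the kernel of the counit on the subalgebra $\langle\chi x\rangle$ generated by $\chi x$. Then $I$ is a Hopf $*$-ideal; put $A_{p,q}=D(\mathscr A_0)/I$, with the induced Hopf algebra structure and involution. In $A_{p,q}$ let $x$ and $e_g$ be the classes of $1\#x$ and $e_g\#1$, let $y$ be the class of $\sum_{1\le j\le q}E_{a;x^j}$,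 and let $z_i$ be the class of $E_{1;x^i}$. The indices $i,j$ of the $z$'s are read modulo $q$, and $t^{-i}$ denotes $t^{m}$ with $0\le m<q$ and $m\equiv -i\pmod q$. **Theorem.** $A_{p,q}$ is a $C^*$-Hopf algebra, i.e. a semisimple Hopf $*$-algebra over $\mathbb C$ whose underlying $*$-algebra is a $C^*$-algebra. As a unital associative $\mathbb C$-algebra it is presented by the generators $x,\ y,\ z_i\ (1\le i\le q),\ e_g\ (g\in G)$ and the relations $$yx=xy^t,\quad z_ix=xz_i,\quad e_gx=xe_{g\triangleleft x},\quad z_iy=yz_i,\quad e_gy=y\sum_{1\le i\le q}z_i\,e_{(a^{-1}\triangleleft x^i)\,g\,a},\quad e_gz_i=z_ie_g,$$ $$x^q=y^p=1,\quad z_iz_j=\delta_{i,j}z_i,\quad e_ge_h=\delta_{g,h}e_g,\quad \sum_{1\le i\le q}z_i=1,\quad \sum_{g\in G}e_g=1 .$$ The coproduct, counit, involution and antipode are given by $$\Delta(x)=x\otimes x,\quad \Delta(y)=\sum_{1\le i\le q}y^{t^i}\otimes yz_i,\quad \Delta(z_i)=\sum_{1\le j\le q}z_j\otimes z_{i-j},\quad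 \Delta(e_g)=\sum_{h\in G}e_h\otimes e_{h^{-1}g},$$ $$\epsilon(x)=\epsilon(y)=1,\quad \epsilon(z_i)=\delta_{i,0},\quad \epsilon(e_g)=\delta_{g,1},$$ $$x^*=x^{-1},\quad y^*=y^{-1},\quad z_i^*=z_i,\quad e_g^*=e_g,$$ $$S(x)=x^{-1},\quad S(y)=\sum_{1\le i\le q}y^{-t^{-i}}z_i,\quad S(z_i)=z_{-i},\quad S(e_g)=e_{g^{-1}}.$$ -/

import Mathlib

open scoped TensorProduct

set_option linter.unusedSectionVars false

noncomputable section

namespace DrinfeldDouble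

open Coalgebra HopfAlgebra Module

section General

variable (k H : Type*) [Field k] [Ring H]

namespace CoopDual

variable [Algebra k H] [Module.Finite k H]

/-- The comultiplication of `H^*`: `Δ(f) = ∑ f₁ ⊗ f₂` with `∑ f₁(a) f₂(b) = f (a * b)`. -/
def dualComul : Dual k H →ₗ[k] Dual k H ⊗[k] Dual k H :=
  (TensorProduct.dualDistribEquiv k H H).symm.toLinearMap ∘ₗ (LinearMap.mul' k H).dualMap

/-- The coalgebra structure of `H^{*cop}` on the linear dual of a finite-dimensional algebra:
the flipped comultiplication of `H^*`, and the counit `f ↦ f 1`. -/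
instance : CoalgebraStruct k (Dual k H) where
  comul := (TensorProduct.comm k (Dual k H) (Dual k H)).toLinearMap ∘ₗ dualComul k H
  counit := Dual.eval k H 1

variable {k H}

lemma counit_apply (f : Dual k H) : counit (R := k) f = f 1 := rfl

lemma dualDistrib_dualComul (f : Dual k H) (a b : H) :
    TensorProduct.dualDistrib k H H (dualComul k H f) (a ⊗ₜ b) = f (a * b) := by
  have : TensorProduct.dualDistrib k H H (dualComul k H f) = (LinearMap.mul' k H).dualMap f :=
    (TensorProduct.dualDistribEquiv k H H).apply_symm_apply _
  rw [this]; simp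

lemma dualDistrib_comul (f : Dual k H) (a b : H) :
    TensorProduct.dualDistrib k H H (comul (R := k) f) (a ⊗ₜ b) = f (b * a) := by
  rw [← dualDistrib_dualComul (k := k) (H := H)]
  change TensorProduct.dualDistrib k H H
    (TensorProduct.comm k (Dual k H) (Dual k H) (dualComul k H f)) (a ⊗ₜ b) = _
  generalize dualComul k H f = w
  induction w with
  | zero => simp
  | tmul x y => simp [mul_comm]
  | add x y hx hy => simp only [map_add, LinearMap.add_apply, hx, hy]

lemma ext_dualDistrib {w w' : Dual k H ⊗[k] Dual k H}
    (h : ∀ a b, TensorProduct.dualDistrib k H H w (a ⊗ₜ b) =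
      TensorProduct.dualDistrib k H H w' (a ⊗ₜ b)) : w = w' := by
  apply (TensorProduct.dualDistribEquiv k H H).injective
  exact TensorProduct.ext' h

lemma ext_dualDistrib₃ {w w' : Dual k H ⊗[k] (Dual k H ⊗[k] Dual k H)}
    (h : ∀ a b c, TensorProduct.dualDistrib k H (H ⊗[k] H)
        ((TensorProduct.dualDistrib k H H).lTensor _ w) (a ⊗ₜ (b ⊗ₜ c)) =
      TensorProduct.dualDistrib k H (H ⊗[k] H)
        ((TensorProduct.dualDistrib k H H).lTensor _ w') (a ⊗ₜ (b ⊗ₜ c))) : w = w' := by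
  have h1 : Function.Injective ((TensorProduct.dualDistrib k H H).lTensor (Dual k H)) :=
    ((TensorProduct.dualDistribEquiv k H H).lTensor (Dual k H)).injective
  apply h1
  apply (TensorProduct.dualDistribEquiv k H (H ⊗[k] H)).injective
  apply TensorProduct.ext
  ext a : 1
  apply TensorProduct.ext'
  intro b c
  exact h a b c

instance : Coalgebra k (Dual k H) where
  coassoc := by
    refine LinearMap.ext fun f => ext_dualDistrib₃ fun a b c => ?_
    simp only [LinearMap.comp_apply, LinearEquiv.coe_coe]
    trans f (c * b * a)
    · have key : ∀ w : Dual k H ⊗[k] Dual k H,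
          TensorProduct.dualDistrib k H (H ⊗[k] H) ((TensorProduct.dualDistrib k H H).lTensor _
            (TensorProduct.assoc k _ _ _ ((comul (R := k)).rTensor _ w))) (a ⊗ₜ (b ⊗ₜ c)) =
          TensorProduct.dualDistrib k H H w ((b * a) ⊗ₜ c) := by
        intro w
        induction w with
        | zero => simp
        | add x y hx hy => simp only [map_add, LinearMap.add_apply, hx, hy]
        | tmul x y =>
          rw [LinearMap.rTensor_tmul, TensorProduct.dualDistrib_apply, ← dualDistrib_comul x a b]
          generalize comul (R := k) x = v
          induction v with
          | zero => simp
          | add x y hx hy => simp only [map_add, LinearMap.add_apply, hx, hy, TensorProduct.add_tmul, add_mul]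
          | tmul u v => simp [mul_assoc]
      rw [key, dualDistrib_comul, mul_assoc]
    · symm
      have key : ∀ w : Dual k H ⊗[k] Dual k H,
          TensorProduct.dualDistrib k H (H ⊗[k] H) ((TensorProduct.dualDistrib k H H).lTensor _
            ((comul (R := k)).lTensor _ w)) (a ⊗ₜ (b ⊗ₜ c)) =
          TensorProduct.dualDistrib k H H w (a ⊗ₜ (c * b)) := by
        intro w
        induction w with
        | zero => simp
        | add x y hx hy => simp only [map_add, LinearMap.add_apply, hx, hy]
        | tmul x y =>
          rw [LinearMap.lTensor_tmul, TensorProduct.dualDistrib_apply, ← dualDistrib_comul y b c]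
          simp
      rw [key, dualDistrib_comul]
  rTensor_counit_comp_comul := by
    refine LinearMap.ext fun f => ?_
    have key : ∀ w : Dual k H ⊗[k] Dual k H, ∀ b : H,
        TensorProduct.lid k (Dual k H) ((counit (R := k)).rTensor (Dual k H) w) b =
        TensorProduct.dualDistrib k H H w (1 ⊗ₜ b) := by
      intro w b
      induction w with
      | zero => simp
      | add x y hx hy => simp only [map_add, LinearMap.add_apply, hx, hy]
      | tmul x y => rfl
    apply (TensorProduct.lid k (Dual k H)).injective
    refine LinearMap.ext fun b => ?_
    rw [LinearMap.comp_apply, key, dualDistrib_comul]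
    simp
  lTensor_counit_comp_comul := by
    refine LinearMap.ext fun f => ?_
    have key : ∀ w : Dual k H ⊗[k] Dual k H, ∀ b : H,
        TensorProduct.rid k (Dual k H) ((counit (R := k)).lTensor (Dual k H) w) b =
        TensorProduct.dualDistrib k H H w (b ⊗ₜ 1) := by
      intro w b
      induction w with
      | zero => simp
      | add x y hx hy => simp only [map_add, LinearMap.add_apply, hx, hy]
      | tmul x y => exact mul_comm _ _
    apply (TensorProduct.rid k (Dual k H)).injective
    refine LinearMap.ext fun b => ?_
    rw [LinearMap.comp_apply, key, dualDistrib_comul]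
    simp

end CoopDual

variable [HopfAlgebra k H]

/-- The underlying vector space of the Drinfel'd double `D(H)`. For `H` finite-dimensional its
coalgebra structure is the tensor product of the coalgebras `H^{*cop}` and `H`. -/
abbrev Double : Type _ := Dual k H ⊗[k] H

namespace Double

/-- The inverse of the antipode (the antipode of a finite-dimensional Hopf algebra is a bijective
linear map; `Ring.inverse` is its inverse in the ring of linear endomorphisms). -/
def antipodeInv : H →ₗ[k] H := Ring.inverse (antipode k (A := H) : Module.End k H)

/-- The multiplication `f g` of the dual Hopf algebra `H^*`: `(f g)(a) = ∑ f(a₁) g(a₂)`. -/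
def dualMul : Dual k H →ₗ[k] Dual k H →ₗ[k] Dual k H :=
  LinearMap.mk₂ k (fun f g => TensorProduct.dualDistrib k H H (f ⊗ₜ g) ∘ₗ comul)
    (by intros; ext; simp [TensorProduct.add_tmul])
    (by intros; ext; simp [← TensorProduct.smul_tmul'])
    (by intros; ext; simp [TensorProduct.tmul_add])
    (by intros; ext; simp)

/-- `a ⇀ g ↼ b`, that is `⟨a ⇀ g ↼ b, c⟩ = ⟨g, b * c * a⟩`, as a linear map in `a`, `b` and `g`. -/
def hit : H →ₗ[k] H →ₗ[k] Dual k H →ₗ[k] Dual k H :=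
  LinearMap.mk₂ k (fun a b => (LinearMap.mulLeft k b ∘ₗ LinearMap.mulRight k a).dualMap)
    (by intros; ext; simp [mul_add])
    (by intros; ext; simp)
    (by intros; ext; simp [add_mul])
    (by intros; ext; simp)

variable {k H} in
lemma hit_apply (a b : H) (g : Dual k H) (c : H) : hit k H a b g c = g (b * (c * a)) := rfl

/-- The linear map sending `a ⊗ b ⊗ c` and `g` to `(a ⇀ g ↼ S⁻¹(c)) ⊗ b`. -/
def exchangeAux : H ⊗[k] (H ⊗[k] H) →ₗ[k] Dual k H →ₗ[k] Double k H :=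
  TensorProduct.lift (LinearMap.mk₂ k
    (fun b w => (TensorProduct.mk k (Dual k H) H).flip b ∘ₗ
      TensorProduct.lift ((hit k H).compl₂ (antipodeInv k H)) w)
    (by intros; apply LinearMap.ext; intro; simp)
    (by intros; apply LinearMap.ext; intro; simp)
    (by intros; apply LinearMap.ext; intro; simp)
    (by intros; apply LinearMap.ext; intro; simp)) ∘ₗ
    (TensorProduct.leftComm k H H H).toLinearMap

variable {k H} in
lemma exchangeAux_tmul (a b c : H) (g : Dual k H) :
    exchangeAux k H (a ⊗ₜ (b ⊗ₜ c)) g = hit k H a (antipodeInv k H c) g ⊗ₜ b := rfl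

/-- The product `h · g = ∑ (h₁ ⇀ g ↼ S⁻¹(h₃)) ⊗ h₂` in `D(H)` of `h ∈ H` and `g ∈ H^*`. -/
def exchange : H →ₗ[k] Dual k H →ₗ[k] Double k H :=
  exchangeAux k H ∘ₗ (comul (R := k)).lTensor H ∘ₗ comul

/-- The linear map `d ↦ f d l` of `D(H)`, that is `g ⊗ h ↦ (f g) ⊗ (h l)`. -/
def sandwich : Dual k H →ₗ[k] H →ₗ[k] Double k H →ₗ[k] Double k H :=
  LinearMap.mk₂ k (fun f l => TensorProduct.map (dualMul k H f) (LinearMap.mulRight k l))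
    (by intros; simp [TensorProduct.map_add_left])
    (by intros; simp [TensorProduct.map_smul_left])
    (by intros; apply TensorProduct.ext'; intros; simp [mul_add, TensorProduct.tmul_add])
    (by intros; apply TensorProduct.ext'; intros; simp)

/-- The multiplication of the Drinfel'd double:
`(f ⊗ h) (g ⊗ l) = ∑ f (h₁ ⇀ g ↼ S⁻¹(h₃)) ⊗ h₂ l`. -/
def mulMap : Double k H →ₗ[k] Double k H →ₗ[k] Double k H :=
  TensorProduct.lift (LinearMap.mk₂ k
    (fun f h => TensorProduct.lift (LinearMap.mk₂ k
      (fun g l => sandwich k H f l (exchange k H h g))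
      (by intros; simp only [map_add])
      (by intros; simp only [map_smul])
      (by intros; simp only [map_add, LinearMap.add_apply])
      (by intros; simp only [map_smul, LinearMap.smul_apply])))
    (by intros; apply TensorProduct.ext'; intros; simp)
    (by intros; apply TensorProduct.ext'; intros; simp)
    (by intros; apply TensorProduct.ext'; intros; simp)
    (by intros; apply TensorProduct.ext'; intros; simp))

variable {k H} in
lemma mulMap_tmul (f g : Dual k H) (h l : H) :
    mulMap k H (f ⊗ₜ h) (g ⊗ₜ l) = sandwich k H f l (exchange k H h g) := rfl

/-- The antipode of the Drinfel'd double: `S(f ⊗ h) = (1 ⊗ S(h)) (f ∘ S⁻¹ ⊗ 1)`. -/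
def antipodeMap : Double k H →ₗ[k] Double k H :=
  TensorProduct.lift (LinearMap.mk₂ k
    (fun f h => mulMap k H (counit ⊗ₜ antipode k h) ((f ∘ₗ antipodeInv k H) ⊗ₜ 1))
    (by intros; simp only [LinearMap.add_comp, TensorProduct.add_tmul, map_add])
    (by intros; simp only [LinearMap.smul_comp, ← TensorProduct.smul_tmul', map_smul])
    (by intros; simp only [map_add, TensorProduct.tmul_add, LinearMap.add_apply])
    (by intros; simp only [map_smul, TensorProduct.tmul_smul, LinearMap.smul_apply]))

variable {k H} in
lemma antipodeMap_tmul (f : Dual k H) (h : H) : antipodeMap k H (f ⊗ₜ h) =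
    mulMap k H (counit ⊗ₜ antipode k h) ((f ∘ₗ antipodeInv k H) ⊗ₜ 1) := rfl

end Double

end General

namespace Double

section Star

variable (H : Type*) [Ring H] [HopfAlgebra ℂ H] [StarRing H] [StarModule ℂ H]

/-- The involution of the dual of a Hopf `*`-algebra: `f^*(a) = conj (f (S(a)^*))`. -/
def dualStar : Dual ℂ H →ₛₗ[starRingEnd ℂ] Dual ℂ H where
  toFun f :=
    { toFun := fun a => star (f (star (antipode ℂ a)))
      map_add' := by intros; simp
      map_smul' := by intros; simp }
  map_add' := by intros; ext; simp
  map_smul' := by intros; ext; simp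

variable {H} in
lemma dualStar_apply (f : Dual ℂ H) (a : H) :
    dualStar H f a = star (f (star (antipode ℂ a))) := rfl

/-- The involution of the Drinfel'd double: `(f ⊗ h)^* = (1 ⊗ h^*) (f^* ⊗ 1)`. -/
def starMap : Double ℂ H →ₛₗ[starRingEnd ℂ] Double ℂ H :=
  TensorProduct.lift (LinearMap.mk₂'ₛₗ (starRingEnd ℂ) (starRingEnd ℂ)
    (fun f h => mulMap ℂ H (counit ⊗ₜ star h) (dualStar H f ⊗ₜ 1))
    (by intros; simp only [map_add, TensorProduct.add_tmul])
    (by intros; simp only [LinearMap.map_smulₛₗ, ← TensorProduct.smul_tmul', map_smul])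
    (by intros; simp only [star_add, map_add, TensorProduct.tmul_add, LinearMap.add_apply])
    (by intros; simp only [star_smul, map_smul, TensorProduct.tmul_smul, LinearMap.smul_apply]; rfl))

variable {H} in
lemma starMap_tmul (f : Dual ℂ H) (h : H) :
    starMap H (f ⊗ₜ h) = mulMap ℂ H (counit ⊗ₜ star h) (dualStar H f ⊗ₜ 1) := rfl

end Star

end Double

end DrinfeldDouble
end


noncomputable section

open scoped Classical in
/-- A multilinear identity may be checked on a basis. -/
lemma Module.Basis.induction_on' {ι R M : Type*} [CommRing R] [AddCommGroup M] [Module R M]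
    (b : Module.Basis ι R M) {P : M → Prop} (x : M) (h0 : P 0) (ha : ∀ x y, P x → P y → P (x + y))
    (hs : ∀ (c : R) x, P x → P (c • x)) (hb : ∀ i, P (b i)) : P x := by
  have hx : x ∈ Submodule.span R (Set.range b) := b.mem_span x
  induction hx using Submodule.span_induction with
  | mem x h => obtain ⟨i, rfl⟩ := h; exact hb i
  | zero => exact h0
  | add x y _ _ hx hy => exact ha x y hx hy
  | smul c x _ hx => exact hs c x hx

/-- For finite groups `G` and `F` (with `F` commutative) and an action `g ◁ f = α f g` of `F` on `G`
by group automorphisms, `SmashHopf α` is the underlying vector space of the abelian extension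
`ℂ^G # ℂF` given by this action, the trivial action of `G` on `F`, and the trivial cocycles
`σ = 1`, `τ = 1`. It has the basis `e_g # f`, for `g ∈ G` and `f ∈ F`. -/
def SmashHopf {G F : Type} [Group G] [CommGroup F] (_α : F →* MulAut G) : Type := G × F →₀ ℂ

namespace SmashHopf

open Module Coalgebra HopfAlgebra

variable {G F : Type} [Group G] [CommGroup F] (α : F →* MulAut G)

instance : AddCommGroup (SmashHopf α) := inferInstanceAs (AddCommGroup (G × F →₀ ℂ))
instance : Module ℂ (SmashHopf α) := inferInstanceAs (Module ℂ (G × F →₀ ℂ))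

/-- The basis `(e_g # f)` of `ℂ^G # ℂF`. -/
def basis : Basis (G × F) ℂ (SmashHopf α) := Basis.ofRepr (LinearEquiv.refl ℂ (G × F →₀ ℂ))

/-- The basis element `e_g # f`. -/
def e (g : G) (f : F) : SmashHopf α := basis α (g, f)

lemma basis_apply (u : G × F) : basis α u = e α u.1 u.2 := rfl

lemma repr_e (g : G) (f : F) : (basis α).repr (e α g f) = Finsupp.single (g, f) 1 :=
  (basis α).repr_self _

instance [Finite G] [Finite F] : Module.Finite ℂ (SmashHopf α) := Module.Finite.of_basis (basis α)

section mul

open scoped Classical in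
/-- `(e_g # f) (e_h # f') = δ_{g ◁ f, h} e_g # f f'`. -/
def mulMap : SmashHopf α →ₗ[ℂ] SmashHopf α →ₗ[ℂ] SmashHopf α :=
  (basis α).constr ℂ fun u => (basis α).constr ℂ fun v =>
    if α u.2 u.1 = v.1 then e α u.1 (u.2 * v.2) else 0

open scoped Classical in
lemma mulMap_e (g h : G) (f f' : F) :
    mulMap α (e α g f) (e α h f') = if α f g = h then e α g (f * f') else 0 := by
  simp [mulMap, e, Basis.constr_basis]

variable [Fintype G] [Fintype F]

instance : Mul (SmashHopf α) := ⟨fun a b => mulMap α a b⟩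
instance : One (SmashHopf α) := ⟨∑ g : G, e α g 1⟩

lemma mul_def (a b : SmashHopf α) : a * b = mulMap α a b := rfl
lemma one_def : (1 : SmashHopf α) = ∑ g : G, e α g 1 := rfl

open scoped Classical in
lemma e_mul_e (g h : G) (f f' : F) :
    e α g f * e α h f' = if α f g = h then e α g (f * f') else 0 := mulMap_e α g h f f'

lemma mulMap_assoc (x y z : SmashHopf α) : x * y * z = x * (y * z) := by
  simp only [mul_def]
  induction x using (basis α).induction_on' with
  | h0 => simp
  | ha x y hx hy => simp [hx, hy]
  | hs c x hx => simp [hx]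
  | hb u =>
  induction y using (basis α).induction_on' with
  | h0 => simp
  | ha x y hx hy => simp [hx, hy]
  | hs c x hx => simp [hx]
  | hb v =>
  induction z using (basis α).induction_on' with
  | h0 => simp
  | ha x y hx hy => simp [hx, hy]
  | hs c x hx => simp [hx]
  | hb w =>
  simp only [basis_apply, mulMap_e]
  by_cases h1 : α u.2 u.1 = v.1
  · have h3 : α (u.2 * v.2) u.1 = α v.2 v.1 := by rw [mul_comm]; simp [h1]
    by_cases h2 : α v.2 v.1 = w.1
    · simp only [h1, h2, h3, mulMap_e, if_true, mul_assoc]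
    · simp only [h1, h2, h3, mulMap_e, if_true, if_false, map_zero]
  · by_cases h2 : α v.2 v.1 = w.1
    · simp [mulMap_e, h1, h2]
    · simp [h1, h2]

lemma one_mulMap (x : SmashHopf α) : 1 * x = x := by
  simp only [mul_def]
  induction x using (basis α).induction_on' with
  | h0 => simp
  | ha x y hx hy => simp [hx, hy]
  | hs c x hx => simp [hx]
  | hb u => classical simp [one_def, basis_apply, mulMap_e]

lemma mulMap_one (x : SmashHopf α) : x * 1 = x := by
  simp only [mul_def]
  induction x using (basis α).induction_on' with
  | h0 => simp
  | ha x y hx hy => simp [hx, hy]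
  | hs c x hx => simp [hx]
  | hb u => classical simp [one_def, basis_apply, mulMap_e]

instance : Ring (SmashHopf α) where
  __ := (inferInstance : AddCommGroup (SmashHopf α))
  mul := (· * ·)
  one := 1
  left_distrib a b c := by simp [mul_def]
  right_distrib a b c := by simp [mul_def]
  zero_mul a := by simp [mul_def]
  mul_zero a := by simp [mul_def]
  mul_assoc := mulMap_assoc α
  one_mul := one_mulMap α
  mul_one := mulMap_one α

instance : Algebra ℂ (SmashHopf α) :=
  Algebra.ofModule (fun c a b => by simp [mul_def]) (fun c a b => by simp [mul_def])

end mul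

variable [Fintype G] [Fintype F]

open scoped Classical in
/-- `Δ(e_g # f) = ∑_{g' g'' = g} e_{g'} # f ⊗ e_{g''} # f` and `ε(e_g # f) = δ_{g, 1}`. -/
instance : CoalgebraStruct ℂ (SmashHopf α) where
  comul := (basis α).constr ℂ fun u => ∑ g : G, e α g u.2 ⊗ₜ e α (g⁻¹ * u.1) u.2
  counit := (basis α).constr ℂ fun u => if u.1 = 1 then 1 else 0

lemma comul_e (g : G) (f : F) :
    comul (R := ℂ) (e α g f) = ∑ h : G, e α h f ⊗ₜ[ℂ] e α (h⁻¹ * g) f :=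
  (basis α).constr_basis ℂ _ _

open scoped Classical in
lemma counit_e (g : G) (f : F) : counit (R := ℂ) (e α g f) = if g = 1 then 1 else 0 :=
  (basis α).constr_basis ℂ _ _

instance : Coalgebra ℂ (SmashHopf α) where
  coassoc := by
    refine (basis α).ext fun u => ?_
    simp only [basis_apply, LinearMap.comp_apply, comul_e, map_sum, LinearMap.rTensor_tmul,
      LinearMap.lTensor_tmul, TensorProduct.sum_tmul, TensorProduct.tmul_sum, LinearEquiv.coe_coe,
      TensorProduct.assoc_tmul]
    rw [Finset.sum_comm]
    refine Finset.sum_congr rfl fun g _ => ?_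
    refine Fintype.sum_equiv (Equiv.mulLeft g⁻¹) _ _ fun h => ?_
    simp [mul_assoc]
  rTensor_counit_comp_comul := by
    classical
    refine (basis α).ext fun u => ?_
    simp [basis_apply, comul_e, counit_e, TensorProduct.ite_tmul]
  lTensor_counit_comp_comul := by
    classical
    refine (basis α).ext fun u => ?_
    simp [basis_apply, comul_e, counit_e, TensorProduct.tmul_ite, inv_mul_eq_one]

lemma comul_mul' (x y : SmashHopf α) :
    comul (R := ℂ) (x * y) = comul (R := ℂ) x * comul (R := ℂ) y := by
  induction x using (basis α).induction_on' with
  | h0 => simp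
  | ha x y hx hy => simp [hx, hy, add_mul]
  | hs c x hx => rw [smul_mul_assoc, map_smul, hx, map_smul]; exact (smul_mul_assoc c _ _).symm
  | hb u =>
  induction y using (basis α).induction_on' with
  | h0 => simp
  | ha x y hx hy => simp [hx, hy, mul_add]
  | hs c x hx => rw [mul_smul_comm, map_smul, hx, map_smul]; exact (mul_smul_comm c _ _).symm
  | hb v =>
  classical
  simp only [basis_apply, comul_e, e_mul_e, Finset.sum_mul_sum, Algebra.TensorProduct.tmul_mul_tmul,
    apply_ite (comul (R := ℂ)), map_zero, TensorProduct.ite_tmul, TensorProduct.tmul_ite]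
  have key : ∀ x j : G, ∀ X : SmashHopf α ⊗[ℂ] SmashHopf α,
      (if α u.2 (x⁻¹ * u.1) = j⁻¹ * v.1 then if α u.2 x = j then X else 0 else 0) =
      if α u.2 x = j then if α u.2 u.1 = v.1 then X else 0 else 0 := by
    intro x j X
    by_cases h : α u.2 x = j
    · subst h; simp
    · simp [h]
  simp only [key, Finset.sum_ite_eq, Finset.mem_univ, if_true]
  split_ifs <;> simp

lemma counit_mul' (x y : SmashHopf α) :
    counit (R := ℂ) (x * y) = counit (R := ℂ) x * counit (R := ℂ) y := by
  induction x using (basis α).induction_on' with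
  | h0 => simp
  | ha x y hx hy => simp [hx, hy, add_mul]
  | hs c x hx => simp [hx, mul_assoc]
  | hb u =>
  induction y using (basis α).induction_on' with
  | h0 => simp
  | ha x y hx hy => simp [hx, hy, mul_add]
  | hs c x hx => simp [hx, mul_left_comm]
  | hb v =>
  classical
  simp only [basis_apply, e_mul_e, apply_ite (counit (R := ℂ)), map_zero, counit_e]
  by_cases h : u.1 = 1 <;> simp [h, eq_comm]

instance : Bialgebra ℂ (SmashHopf α) :=
  Bialgebra.mk' ℂ (SmashHopf α)
    (by classical simp [one_def, counit_e])
    (fun {a b} => counit_mul' α a b)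
    (by
      simp only [one_def, map_sum, comul_e, Algebra.TensorProduct.one_def, TensorProduct.sum_tmul,
        TensorProduct.tmul_sum]
      rw [Finset.sum_comm]
      conv_rhs => rw [Finset.sum_comm]
      refine Finset.sum_congr rfl fun g _ => ?_
      exact Fintype.sum_equiv (Equiv.mulLeft g⁻¹) _ _ fun h => by simp)
    (fun {a b} => comul_mul' α a b)

/-- `S(e_g # f) = e_{(g ◁ f)⁻¹} # f⁻¹`. -/
instance : HopfAlgebraStruct ℂ (SmashHopf α) where
  antipode := (basis α).constr ℂ fun u => e α (α u.2 u.1)⁻¹ u.2⁻¹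

lemma antipode_e (g : G) (f : F) : antipode ℂ (e α g f) = e α (α f g)⁻¹ f⁻¹ :=
  (basis α).constr_basis ℂ _ _

instance : HopfAlgebra ℂ (SmashHopf α) where
  mul_antipode_rTensor_comul := by
    classical
    refine (basis α).ext fun u => ?_
    simp only [basis_apply, LinearMap.comp_apply, comul_e, map_sum, LinearMap.rTensor_tmul,
      antipode_e, LinearMap.mul'_apply, e_mul_e, counit_e, Algebra.linearMap_apply,
      apply_ite (algebraMap ℂ (SmashHopf α)), map_one, map_zero, one_def]
    by_cases h : u.1 = 1
    · simp only [h, map_inv]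
      refine Fintype.sum_equiv ((α u.2).toEquiv.trans (Equiv.inv G)) _ _ fun g => ?_
      simp
    · simp [h]
  mul_antipode_lTensor_comul := by
    classical
    refine (basis α).ext fun u => ?_
    simp only [basis_apply, LinearMap.comp_apply, comul_e, map_sum, LinearMap.lTensor_tmul,
      antipode_e, LinearMap.mul'_apply, e_mul_e, counit_e, Algebra.linearMap_apply,
      apply_ite (algebraMap ℂ (SmashHopf α)), map_one, map_zero, one_def]
    by_cases h : u.1 = 1
    · simp [h]
    · simp [h]

/-- `(e_g # f)^* = e_{g ◁ f} # f⁻¹`, extended conjugate-linearly. -/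
def starMap (x : SmashHopf α) : SmashHopf α :=
  ∑ u : G × F, star ((basis α).repr x u) • e α (α u.2 u.1) u.2⁻¹

lemma starMap_add (x y : SmashHopf α) : starMap α (x + y) = starMap α x + starMap α y := by
  simp [starMap, add_smul, Finset.sum_add_distrib]

lemma starMap_smul (c : ℂ) (x : SmashHopf α) : starMap α (c • x) = star c • starMap α x := by
  simp [starMap, Finset.smul_sum, mul_smul]

lemma starMap_zero : starMap α 0 = 0 := by simp [starMap]

lemma starMap_e (g : G) (f : F) : starMap α (e α g f) = e α (α f g) f⁻¹ := by
  classical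
  rw [starMap, Finset.sum_eq_single (g, f)]
  · simp [repr_e]
  · intro u _ hu
    simp [repr_e, hu.symm]
  · simp

instance : StarRing (SmashHopf α) where
  star := starMap α
  star_involutive x := by
    change starMap α (starMap α x) = x
    induction x using (basis α).induction_on' with
    | h0 => simp [starMap_zero]
    | ha x y hx hy => simp [starMap_add, hx, hy]
    | hs c x hx => simp [starMap_smul, hx]
    | hb u => simp [basis_apply, starMap_e]
  star_mul x y := by
    change starMap α (x * y) = starMap α y * starMap α x
    induction x using (basis α).induction_on' with
    | h0 => simp [starMap_zero]
    | ha x y hx hy => simp [starMap_add, add_mul, mul_add, hx, hy]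
    | hs c x hx => simp [starMap_smul, hx]
    | hb u =>
    induction y using (basis α).induction_on' with
    | h0 => simp [starMap_zero]
    | ha x y hx hy => simp [starMap_add, add_mul, mul_add, hx, hy]
    | hs c x hx => simp [starMap_smul, hx]
    | hb v =>
    classical
    simp only [basis_apply, e_mul_e, starMap_e]
    by_cases h : α u.2 u.1 = v.1
    · have h3 : α (u.2 * v.2) u.1 = α v.2 v.1 := by rw [mul_comm]; simp [h]
      have h4 : α v.2⁻¹ (α v.2 v.1) = α u.2 u.1 := by simp [h]
      rw [if_pos h, starMap_e, if_pos h4, h3, mul_inv_rev]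
    · simp [h, Ne.symm h, starMap_zero]
  star_add := starMap_add α

instance : StarModule ℂ (SmashHopf α) := ⟨starMap_smul α⟩

lemma star_e (g : G) (f : F) : star (e α g f) = e α (α f g) f⁻¹ := starMap_e α g f

end SmashHopf

end


noncomputable section

namespace SmashHopf

open Module Coalgebra HopfAlgebra DrinfeldDouble

variable {G F : Type} [Group G] [CommGroup F] (α : F →* MulAut G) [Fintype G] [Fintype F]

/-- The dual basis element `E_{g; f}` of the dual of `ℂ^G # ℂF`. -/
def E (g : G) (f : F) : Dual ℂ (SmashHopf α) := (basis α).coord (g, f)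

open scoped Classical in
lemma E_e (g h : G) (i j : F) : E α g i (e α h j) = if h = g ∧ j = i then 1 else 0 := by
  simp [E, Basis.coord_apply, repr_e, Finsupp.single_apply, Prod.ext_iff]

/-- The basis elements `E_{g; i} ⊗ (e_h # m)` of the double. -/
def B (g : G) (i : F) (h : G) (m : F) : Double ℂ (SmashHopf α) := E α g i ⊗ₜ e α h m

open scoped Classical in
/-- The basis `E_{g; i} ⊗ (e_h # m)` of the double. -/
def dbasis : Basis ((G × F) × (G × F)) ℂ (Double ℂ (SmashHopf α)) :=
  (basis α).dualBasis.tensorProduct (basis α)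

lemma dbasis_apply (u : (G × F) × (G × F)) :
    dbasis α u = B α u.1.1 u.1.2 u.2.1 u.2.2 := by
  classical
  simp only [dbasis, Basis.tensorProduct_apply', Basis.coe_dualBasis]
  rfl

lemma antipode_antipode (x : SmashHopf α) : antipode ℂ (antipode ℂ x) = x := by
  have : antipode ℂ ∘ₗ antipode ℂ = LinearMap.id (R := ℂ) (M := SmashHopf α) :=
    (basis α).ext fun u => by simp [basis_apply, antipode_e]
  exact LinearMap.congr_fun this x

lemma antipodeInv_eq : Double.antipodeInv ℂ (SmashHopf α) = antipode ℂ := by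
  have h : (antipode ℂ : Module.End ℂ (SmashHopf α)) * antipode ℂ = 1 :=
    LinearMap.ext (antipode_antipode α)
  exact Ring.inverse_unit (⟨antipode ℂ, antipode ℂ, h, h⟩ : (Module.End ℂ (SmashHopf α))ˣ)

open scoped Classical in
lemma dualMul_E (g h : G) (i j : F) :
    Double.dualMul ℂ _ (E α g i) (E α h j) = if i = j then E α (g * h) i else 0 := by
  refine (basis α).ext fun u => ?_
  simp only [Double.dualMul, LinearMap.mk₂_apply, LinearMap.comp_apply, basis_apply, comul_e, map_sum,
    TensorProduct.dualDistrib_apply, E_e, mul_ite, mul_one, mul_zero, ← ite_and]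
  rw [Finset.sum_eq_single g]
  · by_cases hij : i = j
    · subst hij
      simp only [E_e, if_true, true_and]
      congr 1
      rw [inv_mul_eq_iff_eq_mul, eq_iff_iff]
      tauto
    · have : ¬ ((g⁻¹ * u.1 = h ∧ u.2 = j) ∧ True ∧ u.2 = i) := by
        rintro ⟨⟨-, h2⟩, -, h1⟩
        exact hij (h1.symm.trans h2)
      simp only [this, hij, if_false, LinearMap.zero_apply]
  · intro v _ hv
    simp [hv]
  · simp

open scoped Classical in
lemma hit_e (u w g : G) (m j : F) :
    Double.hit ℂ _ (e α u m) (Double.antipodeInv ℂ _ (e α w m)) (E α g j) =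
      if u = α j (α m⁻¹ g) ∧ w = (α m⁻¹ g)⁻¹ then E α (α m⁻¹ g) j else 0 := by
  refine (basis α).ext fun v => ?_
  rw [Double.hit_apply, antipodeInv_eq, antipode_e, basis_apply, e_mul_e, apply_ite (_ * ·),
    mul_zero, e_mul_e, apply_ite (E α g j), apply_ite (E α g j), map_zero, E_e,
    apply_ite (fun f : Dual ℂ (SmashHopf α) => f (e α v.1 v.2)), E_e, LinearMap.zero_apply]
  simp only [← ite_and]
  congr 1
  rw [eq_iff_iff]
  have hm : m⁻¹ * (v.2 * m) = v.2 := by rw [mul_comm, mul_inv_cancel_right]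
  have hw : (α m w)⁻¹ = g ↔ w = (α m⁻¹ g)⁻¹ := by
    constructor
    · rintro rfl; simp
    · rintro rfl; simp
  rw [hm, hw]
  constructor
  · rintro ⟨h1, h2, h3, rfl⟩
    subst h3
    have h4 : α m⁻¹ g = v.1 := by simpa using h2
    rw [h4]
    exact ⟨⟨h1.symm, rfl⟩, rfl, rfl⟩
  · rintro ⟨⟨rfl, rfl⟩, h3, rfl⟩
    simp [h3]

lemma exchange_e (h g : G) (m j : F) :
    Double.exchange ℂ _ (e α h m) (E α g j) =
      B α (α m⁻¹ g) j ((α j (α m⁻¹ g))⁻¹ * h * (α m⁻¹ g)) m := by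
  classical
  simp only [Double.exchange, LinearMap.comp_apply, comul_e, map_sum, LinearMap.lTensor_tmul,
    TensorProduct.tmul_sum, LinearMap.sum_apply, Double.exchangeAux_tmul, hit_e, B]
  rw [Finset.sum_eq_single (α j (α m⁻¹ g)),
    Finset.sum_eq_single ((α j (α m⁻¹ g))⁻¹ * h * (α m⁻¹ g))]
  · simp [mul_assoc]
  · intro v _ hv
    rw [if_neg, TensorProduct.zero_tmul]
    rintro ⟨-, h2⟩
    apply hv
    rw [eq_inv_iff_mul_eq_one, mul_assoc, inv_mul_eq_one] at h2
    exact h2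
  · simp
  · intro v _ hv
    refine Finset.sum_eq_zero fun w _ => ?_
    rw [if_neg (fun hh => hv hh.1), TensorProduct.zero_tmul]
  · simp

open scoped Classical in
lemma mulMap_B (g h g' k : G) (i m j n : F) :
    Double.mulMap ℂ _ (B α g i h m) (B α g' j k n) =
      if i = j ∧ h * α m⁻¹ g' = α i (α m⁻¹ g') * α m⁻¹ k then
        B α (g * α m⁻¹ g') i (α m⁻¹ k) (m * n) else 0 := by
  rw [B, B, Double.mulMap_tmul, exchange_e]
  simp only [Double.sandwich, B, LinearMap.mk₂_apply, TensorProduct.map_tmul, dualMul_E,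
    LinearMap.mulRight_apply, e_mul_e]
  by_cases hij : i = j
  · subst hij
    simp only [if_true, true_and, TensorProduct.tmul_ite]
    have : (α m ((α i (α m⁻¹ g'))⁻¹ * h * α m⁻¹ g') = k) ↔ 
        h * α m⁻¹ g' = α i (α m⁻¹ g') * α m⁻¹ k := by
      rw [← inv_mul_eq_iff_eq_mul, ← mul_assoc]
      constructor
      · rintro rfl; simp
      · intro h; rw [h]; simp
    by_cases hk : h * α m⁻¹ g' = α i (α m⁻¹ g') * α m⁻¹ k
    · rw [if_pos hk, if_pos (this.2 hk), mul_assoc, hk, inv_mul_cancel_left]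
    · rw [if_neg hk, if_neg (mt this.1 hk)]
  · simp [hij]

end SmashHopf
end


noncomputable section

namespace SmashHopf

open Module Coalgebra HopfAlgebra DrinfeldDouble

variable {G F : Type} [Group G] [CommGroup F] (α : F →* MulAut G) [Fintype G] [Fintype F]

lemma act_inv_act (m : F) (g : G) : α m⁻¹ (α m g) = g := by simp

lemma act_comm (m n : F) (g : G) : α m (α n g) = α n (α m g) := by
  rw [← MulAut.mul_apply, ← map_mul, mul_comm, map_mul, MulAut.mul_apply]

open scoped Classical in
lemma mulMap_B' (g h g' k : G) (i m j n : F) :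
    Double.mulMap ℂ _ (B α g i h m) (B α (α m g') j (α m k) n) =
      if i = j ∧ h * g' = α i g' * k then B α (g * g') i k (m * n) else 0 := by
  rw [mulMap_B, act_inv_act, act_inv_act]

lemma double_induction {P : Double ℂ (SmashHopf α) → Prop} (x : Double ℂ (SmashHopf α))
    (h0 : P 0) (ha : ∀ x y, P x → P y → P (x + y)) (hs : ∀ (c : ℂ) x, P x → P (c • x))
    (hb : ∀ g i h m, P (B α g i h m)) : P x :=
  (dbasis α).induction_on' x h0 ha hs fun u => by rw [dbasis_apply]; exact hb _ _ _ _

/-- The unit `1 ⊗ 1` of the double; the unit of `H^*` is the counit of `H`. -/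
def doubleOne : Double ℂ (SmashHopf α) := counit ⊗ₜ 1

lemma counit_eq_sum : (counit : Dual ℂ (SmashHopf α)) = ∑ i : F, E α 1 i := by
  classical
  refine (basis α).ext fun u => ?_
  rw [LinearMap.sum_apply, basis_apply, counit_e]
  by_cases h : u.1 = 1 <;> simp [E_e, h]

lemma doubleOne_eq : doubleOne α = ∑ i : F, ∑ h : G, B α 1 i h 1 := by
  rw [doubleOne, counit_eq_sum, one_def, TensorProduct.sum_tmul]
  simp only [TensorProduct.tmul_sum, B]

lemma double_mul_assoc (x y z : Double ℂ (SmashHopf α)) :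
    Double.mulMap ℂ _ (Double.mulMap ℂ _ x y) z = Double.mulMap ℂ _ x (Double.mulMap ℂ _ y z) := by
  induction x using double_induction with
  | h0 => simp
  | ha x y hx hy => simp [hx, hy]
  | hs c x hx => simp [hx]
  | hb g i h m =>
  induction y using double_induction with
  | h0 => simp
  | ha x y hx hy => simp [hx, hy]
  | hs c x hx => simp [hx]
  | hb g' j k n =>
  induction z using double_induction with
  | h0 => simp
  | ha x y hx hy => simp [hx, hy]
  | hs c x hx => simp [hx]
  | hb g'' l k' r =>
  classical
  obtain ⟨g', rfl⟩ := (α m).surjective g'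
  obtain ⟨k, rfl⟩ := (α m).surjective k
  obtain ⟨g'', rfl⟩ := (α (m * n)).surjective g''
  obtain ⟨k', rfl⟩ := (α (m * n)).surjective k'
  have h1 : Double.mulMap ℂ _ (B α (α m g') j (α m k) n)
      (B α (α (m * n) g'') l (α (m * n) k') r) =
      if j = l ∧ k * g'' = α j g'' * k' then B α (α m (g' * g'')) j (α m k') (n * r) else 0 := by
    rw [mul_comm m n, map_mul, MulAut.mul_apply, MulAut.mul_apply, mulMap_B', act_comm α j m,
      ← map_mul, ← map_mul, ← map_mul, (α m).injective.eq_iff]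
  rw [h1, mulMap_B']
  by_cases h2 : j = l ∧ k * g'' = α j g'' * k'
  · rw [if_pos h2, mulMap_B']
    by_cases h3 : i = j ∧ h * g' = α i g' * k
    · obtain ⟨rfl, h4⟩ := h3
      obtain ⟨rfl, h5⟩ := h2
      rw [if_pos ⟨rfl, h4⟩, mulMap_B', if_pos ⟨rfl, h5⟩, if_pos, mul_assoc, mul_assoc]
      refine ⟨rfl, ?_⟩
      rw [← mul_assoc, h4, mul_assoc, h5, map_mul, mul_assoc]
    · rw [if_neg h3, if_neg, map_zero, LinearMap.zero_apply]
      rintro ⟨rfl, h4⟩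
      apply h3
      refine ⟨rfl, ?_⟩
      rw [map_mul, mul_assoc, ← h2.2, ← mul_assoc, ← mul_assoc] at h4
      exact mul_right_cancel h4
  · rw [if_neg h2, map_zero]
    by_cases h3 : i = j ∧ h * g' = α i g' * k
    · obtain ⟨rfl, h4⟩ := h3
      rw [if_pos ⟨rfl, h4⟩, mulMap_B', if_neg h2]
    · rw [if_neg h3, map_zero, LinearMap.zero_apply]

lemma double_one_mul (x : Double ℂ (SmashHopf α)) : Double.mulMap ℂ _ (doubleOne α) x = x := by
  induction x using double_induction with
  | h0 => simp
  | ha x y hx hy => simp [hx, hy]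
  | hs c x hx => simp [hx]
  | hb g i h m =>
  classical
  simp only [doubleOne_eq, map_sum, LinearMap.sum_apply, mulMap_B, inv_one, map_one,
    MulAut.one_apply, one_mul]
  rw [Finset.sum_eq_single i, Finset.sum_eq_single (α i g * h * g⁻¹)]
  · simp
  · intro v _ hv
    rw [if_neg]
    rintro ⟨-, h2⟩
    exact hv (by rw [← h2]; simp)
  · simp
  · intro j _ hj
    simp [hj]
  · simp

lemma double_mul_one (x : Double ℂ (SmashHopf α)) : Double.mulMap ℂ _ x (doubleOne α) = x := by
  induction x using double_induction with
  | h0 => simp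
  | ha x y hx hy => simp [hx, hy]
  | hs c x hx => simp [hx]
  | hb g i h m =>
  classical
  simp only [doubleOne_eq, map_sum, mulMap_B, map_one, mul_one, one_mul]
  rw [Finset.sum_eq_single i, Finset.sum_eq_single (α m h)]
  · simp
  · intro v _ hv
    rw [if_neg]
    rintro ⟨-, h2⟩
    exact hv (by rw [h2]; simp)
  · simp
  · intro j _ hj
    simp [hj.symm]
  · simp

/-- The Drinfel'd double of `ℂ^G # ℂF` as a ring. -/
instance doubleRing : Ring (Double ℂ (SmashHopf α)) where
  __ := (inferInstance : AddCommGroup (Double ℂ (SmashHopf α)))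
  mul a b := Double.mulMap ℂ _ a b
  one := doubleOne α
  left_distrib a b c := map_add _ _ _
  right_distrib a b c := LinearMap.map_add₂ _ _ _ _
  zero_mul a := LinearMap.map_zero₂ _ _
  mul_zero a := map_zero _
  mul_assoc := double_mul_assoc α
  one_mul := double_one_mul α
  mul_one := double_mul_one α

lemma double_mul_def (a b : Double ℂ (SmashHopf α)) : a * b = Double.mulMap ℂ _ a b := rfl

lemma double_one_def : (1 : Double ℂ (SmashHopf α)) = counit ⊗ₜ 1 := rfl

instance doubleAlgebra : Algebra ℂ (Double ℂ (SmashHopf α)) :=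
  Algebra.ofModule (fun _ _ _ => LinearMap.map_smul₂ _ _ _ _) (fun _ _ _ => map_smul _ _ _)

lemma dualComul_E (g : G) (i : F) :
    comul (R := ℂ) (E α g i) = ∑ j : F, E α (α j g) (i * j⁻¹) ⊗ₜ[ℂ] E α g j := by
  classical
  refine CoopDual.ext_dualDistrib fun a b => ?_
  rw [CoopDual.dualDistrib_comul]
  induction a using (basis α).induction_on' with
  | h0 => simp
  | ha x y hx hy => simp only [hx, hy, mul_add, map_add, TensorProduct.add_tmul]
  | hs c x hx =>
    rw [mul_smul_comm, map_smul, hx, ← TensorProduct.smul_tmul', map_smul]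
  | hb u =>
  induction b using (basis α).induction_on' with
  | h0 => simp
  | ha x y hx hy => simp only [hx, hy, add_mul, map_add, TensorProduct.tmul_add]
  | hs c x hx =>
    rw [smul_mul_assoc, map_smul, hx, TensorProduct.tmul_smul, map_smul]
  | hb v =>
  simp only [basis_apply, e_mul_e, map_sum, LinearMap.sum_apply, TensorProduct.dualDistrib_apply,
    apply_ite (E α g i), E_e, map_zero, mul_ite, mul_one, mul_zero, ← ite_and]
  rw [Finset.sum_eq_single v.2]
  · congr 1
    rw [eq_iff_iff]
    constructor
    · rintro ⟨h1, rfl, rfl⟩; exact ⟨⟨rfl, rfl⟩, h1.symm, by rw [mul_comm v.2, mul_inv_cancel_right]⟩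
    · rintro ⟨⟨rfl, h1⟩, h2, h3⟩; exact ⟨h2.symm, rfl, by rw [h3, mul_comm, inv_mul_cancel_right]⟩
  · intro j _ hj
    rw [if_neg]
    rintro ⟨⟨-, h1⟩, -⟩
    exact hj h1.symm
  · simp

lemma comul_B (g h : G) (i m : F) : comul (R := ℂ) (B α g i h m) =
    ∑ j : F, ∑ u : G, B α (α j g) (i * j⁻¹) u m ⊗ₜ[ℂ] B α g j (u⁻¹ * h) m := by
  rw [B, TensorProduct.comul_tmul, dualComul_E, comul_e, TensorProduct.sum_tmul, map_sum]
  refine Finset.sum_congr rfl fun j _ => ?_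
  rw [TensorProduct.tmul_sum, map_sum]
  rfl

open scoped Classical in
lemma counit_B (g h : G) (i m : F) : counit (R := ℂ) (B α g i h m) =
    if i = 1 ∧ h = 1 then 1 else 0 := by
  rw [B, TensorProduct.counit_tmul, counit_e, CoopDual.counit_apply, one_def, map_sum]
  have : ∑ x : G, E α g i (e α x 1) = if i = 1 then 1 else 0 := by
    simp only [E_e, ite_and]
    simp [eq_comm]
  rw [this]
  by_cases h1 : h = 1 <;> simp [h1]

end SmashHopf
end


noncomputable section

namespace SmashHopf

open Module Coalgebra HopfAlgebra DrinfeldDouble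

variable {G F : Type} [Group G] [CommGroup F] (α : F →* MulAut G) [Fintype G] [Fintype F]

open scoped Classical in
lemma B_mul_B' (g h g' k : G) (i m j n : F) :
    B α g i h m * B α (α m g') j (α m k) n =
      if i = j ∧ h * g' = α i g' * k then B α (g * g') i k (m * n) else 0 :=
  mulMap_B' α g h g' k i m j n

open scoped Classical in
lemma B_mul_B (g h g' k : G) (i m j n : F) :
    B α g i h m * B α g' j k n =
      if i = j ∧ h * α m⁻¹ g' = α i (α m⁻¹ g') * α m⁻¹ k then
        B α (g * α m⁻¹ g') i (α m⁻¹ k) (m * n) else 0 :=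
  mulMap_B α g h g' k i m j n

lemma double_comul_mul (x y : Double ℂ (SmashHopf α)) :
    comul (R := ℂ) (x * y) = comul (R := ℂ) x * comul (R := ℂ) y := by
  induction x using double_induction with
  | h0 => simp
  | ha x y hx hy => simp [hx, hy, add_mul]
  | hs c x hx => rw [smul_mul_assoc, map_smul, hx, map_smul]; exact (smul_mul_assoc c _ _).symm
  | hb g i h m =>
  induction y using double_induction with
  | h0 => simp
  | ha x y hx hy => simp [hx, hy, mul_add]
  | hs c x hx => rw [mul_smul_comm, map_smul, hx, map_smul]; exact (mul_smul_comm c _ _).symm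
  | hb g' j k n =>
  classical
  obtain ⟨g', rfl⟩ := (α m).surjective g'
  obtain ⟨k, rfl⟩ := (α m).surjective k
  have term : ∀ l u l' v, (B α (α l g) (i * l⁻¹) u m ⊗ₜ[ℂ] B α g l (u⁻¹ * h) m) *
      (B α (α l' (α m g')) (j * l'⁻¹) (α m v) n ⊗ₜ[ℂ] B α (α m g') l' ((α m v)⁻¹ * α m k) n) =
      if l' = l then if u = α i g' * v * (α l g')⁻¹ then if i = j ∧ h * g' = α i g' * k then
        B α (α l (g * g')) (i * l⁻¹) v (m * n) ⊗ₜ[ℂ] B α (g * g') l (v⁻¹ * k) (m * n)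
      else 0 else 0 else 0 := by
    intro l u l' v
    rw [Algebra.TensorProduct.tmul_mul_tmul, act_comm α l' m, ← map_inv, ← map_mul, B_mul_B',
      B_mul_B']
    by_cases hl : l' = l
    · subst hl
      rw [if_pos rfl, ← MulAut.mul_apply, ← map_mul, inv_mul_cancel_right]
      by_cases hij : i = j
      · subst hij
        by_cases hu : u = α i g' * v * (α l' g')⁻¹
        · subst hu
          have e1 : (i * l'⁻¹ = i * l'⁻¹ ∧ α i g' * v * (α l' g')⁻¹ * (α l' g') = α i g' * v) := by
            simp
          rw [if_pos e1, if_pos rfl, map_mul]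
          by_cases hh : h * g' = α i g' * k
          · rw [if_pos (c := i = i ∧ _) ⟨rfl, hh⟩,
              if_pos ⟨rfl, by rw [mul_assoc, hh]; group⟩]
          · rw [if_neg (c := i = i ∧ _) (fun hc => hh hc.2), if_neg, TensorProduct.tmul_zero]
            rintro ⟨-, h1⟩
            apply hh
            rw [mul_assoc, inv_mul_eq_iff_eq_mul] at h1
            rw [h1]; group
        · rw [if_neg hu, if_neg, TensorProduct.zero_tmul]
          rintro ⟨-, h1⟩
          exact hu (eq_mul_inv_of_mul_eq h1)
      · rw [if_neg (c := i = j ∧ _) (fun hc => hij hc.1), ite_self, if_neg,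
          TensorProduct.zero_tmul]
        rintro ⟨h1, -⟩
        exact hij (mul_right_cancel h1)
    · rw [if_neg hl, if_neg (c := l = l' ∧ _) (fun hc => hl hc.1.symm), TensorProduct.tmul_zero]
  have reindex : comul (R := ℂ) (B α (α m g') j (α m k) n) = ∑ l' : F, ∑ v : G,
      B α (α l' (α m g')) (j * l'⁻¹) (α m v) n ⊗ₜ[ℂ] B α (α m g') l' ((α m v)⁻¹ * α m k) n := by
    rw [comul_B]
    refine Finset.sum_congr rfl fun l' _ => ?_
    exact (Fintype.sum_equiv (α m).toEquiv _ _ fun v => rfl).symm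
  rw [reindex, comul_B]
  simp only [Finset.sum_mul_sum, term]
  have step : ∀ l : F, (∑ l' : F, ∑ u : G, ∑ v : G,
      if l' = l then if u = α i g' * v * (α l g')⁻¹ then if i = j ∧ h * g' = α i g' * k then
        B α (α l (g * g')) (i * l⁻¹) v (m * n) ⊗ₜ[ℂ] B α (g * g') l (v⁻¹ * k) (m * n)
      else 0 else 0 else 0) = ∑ v : G, if i = j ∧ h * g' = α i g' * k then
        B α (α l (g * g')) (i * l⁻¹) v (m * n) ⊗ₜ[ℂ] B α (g * g') l (v⁻¹ * k) (m * n)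
      else 0 := by
    intro l
    simp only [Finset.sum_ite_irrel, Finset.sum_const_zero, Finset.sum_ite_eq',
      Finset.mem_univ, if_true]
    rw [Finset.sum_comm]
    simp
  simp only [step]
  rw [B_mul_B']
  split_ifs with hc
  · rw [comul_B]
  · simp

lemma double_counit_mul (x y : Double ℂ (SmashHopf α)) :
    counit (R := ℂ) (x * y) = counit (R := ℂ) x * counit (R := ℂ) y := by
  induction x using double_induction with
  | h0 => simp
  | ha x y hx hy => simp only [hx, hy, add_mul, map_add]
  | hs c x hx => rw [smul_mul_assoc, map_smul, hx, map_smul, smul_mul_assoc]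
  | hb g i h m =>
  induction y using double_induction with
  | h0 => simp
  | ha x y hx hy => simp only [hx, hy, mul_add, map_add]
  | hs c x hx => rw [mul_smul_comm, map_smul, hx, map_smul, mul_smul_comm]
  | hb g' j k n =>
  classical
  obtain ⟨g', rfl⟩ := (α m).surjective g'
  obtain ⟨k, rfl⟩ := (α m).surjective k
  rw [B_mul_B', apply_ite (counit (R := ℂ)), counit_B, counit_B, counit_B, map_zero]
  by_cases hi : i = 1
  · subst hi
    by_cases hj : j = 1
    · subst hj
      by_cases hk : k = 1
      · simp [hk]
      · simp [hk]
    · simp [hj, Ne.symm hj]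
  · simp [hi]

instance doubleBialgebra : Bialgebra ℂ (Double ℂ (SmashHopf α)) :=
  Bialgebra.mk' ℂ (Double ℂ (SmashHopf α))
    (by
      rw [double_one_def, TensorProduct.counit_tmul, CoopDual.counit_apply]
      simp)
    (fun {a b} => double_counit_mul α a b)
    (by
      rw [double_one_def, TensorProduct.comul_tmul]
      have : comul (R := ℂ) (counit : Dual ℂ (SmashHopf α)) = counit ⊗ₜ[ℂ] counit := by
        refine CoopDual.ext_dualDistrib fun a b => ?_
        rw [CoopDual.dualDistrib_comul, TensorProduct.dualDistrib_apply, Bialgebra.counit_mul,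
          mul_comm]
      rw [this, Bialgebra.comul_one, Algebra.TensorProduct.one_def]
      rfl)
    (fun {a b} => double_comul_mul α a b)

/-- The Drinfel'd double of `ℂ^G # ℂF` with its antipode. -/
instance doubleHopfStruct : HopfAlgebraStruct ℂ (Double ℂ (SmashHopf α)) where
  antipode := Double.antipodeMap ℂ _

lemma E_comp_antipode (g : G) (i : F) :
    E α g i ∘ₗ Double.antipodeInv ℂ (SmashHopf α) = E α (α i g)⁻¹ i⁻¹ := by
  classical
  rw [antipodeInv_eq]
  refine (basis α).ext fun u => ?_
  rw [basis_apply, LinearMap.comp_apply, antipode_e, E_e, E_e]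
  congr 1
  rw [eq_iff_iff]
  constructor
  · rintro ⟨h1, rfl⟩; simp [← h1]
  · rintro ⟨h1, h2⟩; simp [h1, h2]

lemma dualStar_E (g : G) (i : F) : Double.dualStar _ (E α g i) = E α g⁻¹ i := by
  classical
  refine (basis α).ext fun u => ?_
  rw [Double.dualStar_apply, basis_apply, antipode_e, star_e, E_e, E_e]
  simp [inv_eq_iff_eq_inv]

/-- The product `(1 ⊗ e_h # m) (E_{g; i} ⊗ 1)`. -/
lemma mulMap_counit_one (g h : G) (i m : F) :
    Double.mulMap ℂ _ (counit ⊗ₜ e α h m) (E α g i ⊗ₜ 1) =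
      B α (α m⁻¹ g) i ((α i (α m⁻¹ g))⁻¹ * h * α m⁻¹ g) m := by
  classical
  rw [Double.mulMap_tmul, exchange_e, B]
  simp only [Double.sandwich, LinearMap.mk₂_apply, TensorProduct.map_tmul,
    LinearMap.mulRight_apply, mul_one]
  congr 1
  rw [counit_eq_sum, map_sum, LinearMap.sum_apply]
  simp [dualMul_E]

lemma antipode_B (g h : G) (i m : F) : antipode ℂ (B α g i h m) =
    B α (α m (α i g))⁻¹ i⁻¹ (α m (α i g * h * g⁻¹))⁻¹ m⁻¹ := by
  change Double.antipodeMap ℂ _ (B α g i h m) = _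
  rw [B, Double.antipodeMap_tmul, antipode_e, E_comp_antipode, mulMap_counit_one]
  have : α i⁻¹ (α m (α i g)) = α m g := by rw [act_comm, act_inv_act]
  have h1 : α m⁻¹⁻¹ (α i g)⁻¹ = (α m (α i g))⁻¹ := by simp
  rw [h1, map_inv, this]
  congr 1
  simp [mul_assoc]

instance doubleHopf : HopfAlgebra ℂ (Double ℂ (SmashHopf α)) where
  mul_antipode_rTensor_comul := by
    classical
    refine (dbasis α).ext fun ⟨⟨g, i⟩, ⟨h, m⟩⟩ => ?_
    have term : ∀ j u, antipode ℂ (B α (α j g) (i * j⁻¹) u m) * B α g j (u⁻¹ * h) m =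
        if i = 1 ∧ h = 1 then B α 1 j (α m u⁻¹) 1 else 0 := by
      intro j u
      have e1 : B α g j (u⁻¹ * h) m =
          B α (α m⁻¹ (α m g)) j (α m⁻¹ (α m (u⁻¹ * h))) m := by simp
      have e2 : α (i * j⁻¹) (α j g) = α i g := by
        rw [← MulAut.mul_apply, ← map_mul, inv_mul_cancel_right]
      rw [antipode_B, e1, B_mul_B', e2]
      by_cases hi : i = 1
      · subst hi
        by_cases hh : h = 1
        · subst hh
          rw [if_pos, if_pos ⟨rfl, rfl⟩]
          · simp
          · refine ⟨by simp, ?_⟩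
            rw [← map_inv, ← map_mul, one_mul, inv_inv, act_comm, ← map_mul]
            simp [mul_assoc]
        · rw [if_neg, if_neg (fun hc => hh hc.2)]
          rintro ⟨-, hc⟩
          apply hh
          rw [← map_inv, ← map_mul, one_mul, inv_inv, act_comm, ← map_mul, (α m).injective.eq_iff] at hc
          simpa [mul_assoc, eq_comm] using hc
      · rw [if_neg, if_neg (fun hc => hi hc.1)]
        rintro ⟨hc, -⟩
        apply hi
        simpa [mul_inv_rev, inv_inv] using hc
    simp only [dbasis_apply, LinearMap.comp_apply, comul_B, map_sum, LinearMap.rTensor_tmul,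
      LinearMap.mul'_apply, term, counit_B, Algebra.linearMap_apply]
    split_ifs with hc
    · rw [map_one]
      refine Eq.trans ?_ (doubleOne_eq α).symm
      refine Finset.sum_congr rfl fun j _ => ?_
      exact Fintype.sum_equiv ((Equiv.inv G).trans (α m).toEquiv) _ _ fun v => rfl
    · simp
  mul_antipode_lTensor_comul := by
    classical
    refine (dbasis α).ext fun ⟨⟨g, i⟩, ⟨h, m⟩⟩ => ?_
    have term : ∀ j u, B α (α j g) (i * j⁻¹) u m * antipode ℂ (B α g j (u⁻¹ * h) m) =
        if i = 1 ∧ h = 1 then B α 1 j⁻¹ (g * u * (α j g)⁻¹) 1 else 0 := by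
      intro j u
      have e2 : α (i * j⁻¹) (α j g) = α i g := by
        rw [← MulAut.mul_apply, ← map_mul, inv_mul_cancel_right]
      rw [antipode_B, ← map_inv, ← map_inv (α m), B_mul_B', map_inv, e2]
      by_cases hi : i = 1
      · subst hi
        by_cases hh : h = 1
        · subst hh
          rw [if_pos, if_pos ⟨rfl, rfl⟩]
          · simp [mul_assoc]
          · simp [mul_assoc]
        · rw [if_neg, if_neg (fun hc => hh hc.2)]
          rintro ⟨-, hc⟩
          apply hh
          simpa [mul_assoc] using hc
      · rw [if_neg, if_neg (fun hc => hi hc.1)]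
        rintro ⟨hc, -⟩
        apply hi
        simpa using hc
    simp only [dbasis_apply, LinearMap.comp_apply, comul_B, map_sum, LinearMap.lTensor_tmul,
      LinearMap.mul'_apply, term, counit_B, Algebra.linearMap_apply]
    split_ifs with hc
    · rw [map_one]
      refine Eq.trans ?_ (doubleOne_eq α).symm
      refine Fintype.sum_equiv (Equiv.inv F) _ _ fun j => ?_
      exact Fintype.sum_equiv ((Equiv.mulLeft g).trans (Equiv.mulRight (α j g)⁻¹)) _ _
        fun v => rfl
    · simp

lemma starMap_B (g h : G) (i m : F) : Double.starMap _ (B α g i h m) =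
    B α (α m g⁻¹) i (α m (α i g * h * g⁻¹)) m⁻¹ := by
  rw [B, Double.starMap_tmul, star_e, dualStar_E, mulMap_counit_one]
  simp [mul_assoc, act_comm α i m]

instance doubleStarRing : StarRing (Double ℂ (SmashHopf α)) where
  star := Double.starMap _
  star_involutive x := by
    change Double.starMap _ (Double.starMap _ x) = x
    induction x using double_induction with
    | h0 => simp
    | ha x y hx hy => simp only [map_add, hx, hy]
    | hs c x hx => simp [LinearMap.map_smulₛₗ, hx]
    | hb g i h m =>
      rw [starMap_B, starMap_B]
      simp [mul_assoc, act_comm α i m]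
  star_mul x y := by
    change Double.starMap _ (x * y) = Double.starMap _ y * Double.starMap _ x
    induction x using double_induction with
    | h0 => simp
    | ha x y hx hy => simp only [map_add, hx, hy, add_mul, mul_add]
    | hs c x hx => rw [smul_mul_assoc, LinearMap.map_smulₛₗ, hx, LinearMap.map_smulₛₗ, mul_smul_comm]
    | hb g i h m =>
    induction y using double_induction with
    | h0 => simp
    | ha x y hx hy => simp only [map_add, hx, hy, add_mul, mul_add]
    | hs c x hx => rw [mul_smul_comm, LinearMap.map_smulₛₗ, hx, LinearMap.map_smulₛₗ, smul_mul_assoc]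
    | hb g' j k n =>
    classical
    obtain ⟨g', rfl⟩ := (α m).surjective g'
    obtain ⟨k, rfl⟩ := (α m).surjective k
    have e1 : B α (α m g⁻¹) i (α m (α i g * h * g⁻¹)) m⁻¹ =
        B α (α n⁻¹ (α n (α m g⁻¹))) i (α n⁻¹ (α n (α m (α i g * h * g⁻¹)))) m⁻¹ := by simp
    rw [starMap_B, starMap_B, e1, B_mul_B', B_mul_B']
    have e2 : (j = i ∧ α n (α j (α m g') * α m k * (α m g')⁻¹) * α n (α m g⁻¹) =
        α j (α n (α m g⁻¹)) * α n (α m (α i g * h * g⁻¹))) ↔ (i = j ∧ h * g' = α i g' * k) := by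
      rw [eq_comm (a := j), act_comm α j n, act_comm α j m, act_comm α j m, ← map_mul (α n),
        ← map_mul (α n), (α n).injective.eq_iff, ← map_inv (α m), ← map_mul (α m),
        ← map_mul (α m), ← map_mul (α m), ← map_mul (α m), (α m).injective.eq_iff]
      refine and_congr_right ?_
      rintro rfl
      simp only [map_inv, ← mul_assoc, inv_mul_cancel, one_mul, mul_left_inj]
      rw [mul_inv_eq_iff_eq_mul, eq_comm]
    by_cases hc : i = j ∧ h * g' = α i g' * k
    · rw [if_pos hc, if_pos (e2.2 hc), starMap_B]
      obtain ⟨rfl, hc⟩ := hc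
      have e3 : α i (g * g') * k * (g * g')⁻¹ = α i g * h * g⁻¹ := by
        rw [map_mul, mul_assoc (α i g), ← hc]; group
      rw [e3, mul_comm m n, map_mul, MulAut.mul_apply, MulAut.mul_apply, mul_inv_rev (a := n),
        mul_comm m⁻¹]
      simp
    · rw [if_neg hc, if_neg (mt e2.1 hc), map_zero]
  star_add x y := map_add _ _ _

instance doubleStarModule : StarModule ℂ (Double ℂ (SmashHopf α)) :=
  ⟨fun c x => LinearMap.map_smulₛₗ (Double.starMap _) c x⟩

end SmashHopf
end


noncomputable section

open Module Coalgebra HopfAlgebra DrinfeldDouble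

/-- The parameters: odd primes `p`, `q` with `p ≡ 1 mod q`, a natural number `t` with
`t ^ q ≡ 1 mod p` and `t ≢ 1 mod p`, and a primitive `q`-th root of unity `ω` in `ℂ`. -/
structure Datum where
  p : ℕ
  q : ℕ
  t : ℕ
  ω : ℂ
  p_prime : p.Prime
  q_prime : q.Prime
  p_odd : Odd p
  q_odd : Odd q
  p_mod : p ≡ 1 [MOD q]
  t_pow : t ^ q ≡ 1 [MOD p]
  t_ne : ¬ t ≡ 1 [MOD p]
  ω_prim : IsPrimitiveRoot ω q

namespace Datum

variable (P : Datum)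

instance : Fact P.p.Prime := ⟨P.p_prime⟩
instance : Fact P.q.Prime := ⟨P.q_prime⟩

/-- `t ^ j` modulo `p`, for `j` modulo `q`. -/
def tpow (j : ZMod P.q) : ZMod P.p := (P.t : ZMod P.p) ^ j.val

lemma t_pow' : (P.t : ZMod P.p) ^ P.q = 1 := by
  have := (ZMod.natCast_eq_natCast_iff _ _ _).2 P.t_pow
  simpa using this

lemma pow_mod (n : ℕ) : (P.t : ZMod P.p) ^ (n % P.q) = (P.t : ZMod P.p) ^ n :=
  (pow_eq_pow_mod n P.t_pow').symm

lemma tpow_add (i j : ZMod P.q) : P.tpow (i + j) = P.tpow i * P.tpow j := by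
  rw [tpow, ZMod.val_add, pow_mod, pow_add]; rfl

lemma tpow_zero : P.tpow 0 = 1 := by simp [tpow]

/-- The action of `ℤ_q` on `ℤ_p` in which `j` acts as multiplication by `t ^ j`. -/
def act : Multiplicative (ZMod P.q) →* MulAut (Multiplicative (ZMod P.p)) where
  toFun j := AddEquiv.toMultiplicative
    { toFun := fun i => P.tpow j.toAdd * i
      invFun := fun i => P.tpow (-j.toAdd) * i
      left_inv := fun i => by simp [← mul_assoc, ← tpow_add, tpow_zero]
      right_inv := fun i => by simp [← mul_assoc, ← tpow_add, tpow_zero]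
      map_add' := fun i i' => mul_add _ _ _ }
  map_one' := by
    ext i
    change Multiplicative.ofAdd (P.tpow 0 * i.toAdd) = i
    simp [tpow_zero]
  map_mul' j k := by
    ext i
    change Multiplicative.ofAdd (P.tpow (j.toAdd + k.toAdd) * i.toAdd) =
      Multiplicative.ofAdd (P.tpow j.toAdd * (P.tpow k.toAdd * i.toAdd))
    rw [tpow_add, mul_assoc]

/-- The group `G = ℤ_p ⋊ ℤ_q = ⟨a, b | a ^ p = b ^ q = 1, b a b⁻¹ = a ^ t⟩`. -/
abbrev G : Type := Multiplicative (ZMod P.p) ⋊[P.act] Multiplicative (ZMod P.q)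

instance : Fintype P.G := Fintype.ofEquiv _ SemidirectProduct.equivProd.symm

/-- The group `F = ℤ_q`, generated by `x`; the element `x ^ i` is `Multiplicative.ofAdd i`. -/
abbrev F : Type := Multiplicative (ZMod P.q)

/-- The generator `a` of `G`. -/
def a : P.G := SemidirectProduct.inl (Multiplicative.ofAdd 1)

/-- The generator `b` of `G`. -/
def b : P.G := SemidirectProduct.inr (Multiplicative.ofAdd 1)

/-- The action of `F` on `G`: `g ◁ x ^ i = b ^ i g b ^ (-i)`, so `a ◁ x ^ i = a ^ (t ^ i)` and
`b ◁ x ^ i = b`. -/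
def α : P.F →* MulAut P.G := MulAut.conj.comp SemidirectProduct.inr

/-- `g ◁ x ^ i`. -/
def ract (g : P.G) (i : ZMod P.q) : P.G := P.α (Multiplicative.ofAdd i) g

lemma α_apply (f : P.F) (g : P.G) :
    P.α f g = SemidirectProduct.inr f * g * (SemidirectProduct.inr f)⁻¹ := rfl

lemma inr_val (i : ZMod P.q) :
    (SemidirectProduct.inr (Multiplicative.ofAdd i) : P.G) = P.b ^ i.val := by
  rw [b, ← map_pow, ← ofAdd_nsmul]
  simp

lemma b_mul_a : P.b * P.a * P.b⁻¹ = P.a ^ P.t := by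
  rw [b, a, ← map_inv, ← SemidirectProduct.inl_aut, ← map_pow, ← ofAdd_nsmul]
  congr 1
  change Multiplicative.ofAdd (P.tpow 1 * 1) = _
  have : (1 : ZMod P.q).val = 1 := ZMod.val_one _
  simp [tpow, this]

lemma a_pow : P.a ^ P.p = 1 := by
  rw [a, ← map_pow, ← ofAdd_nsmul]; simp

lemma b_pow : P.b ^ P.q = 1 := by
  rw [b, ← map_pow, ← ofAdd_nsmul]; simp

lemma ract_a (i : ZMod P.q) : P.ract P.a i = P.a ^ P.t ^ i.val := by
  rw [ract, α_apply, a, ← map_inv, ← SemidirectProduct.inl_aut, ← map_pow, ← ofAdd_nsmul]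
  congr 1
  change Multiplicative.ofAdd (P.tpow i * 1) = _
  simp [tpow]

lemma α_b (f : P.F) : P.α f P.b = P.b := by
  rw [α_apply, b, ← map_mul, mul_comm, map_mul, mul_inv_cancel_right]

lemma ract_b (i : ZMod P.q) : P.ract P.b i = P.b := P.α_b _

/-- The Hopf algebra `𝒜₀ = ℂ^G # ℂF`. -/
abbrev A0 : Type := SmashHopf P.α

/-- The element `e_g = e_g # 1` of `𝒜₀`. -/
def e0 (g : P.G) : P.A0 := SmashHopf.e P.α g 1

/-- The generator of `F`. -/
def X : P.F := Multiplicative.ofAdd 1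

/-- The element `x = 1 # x` of `𝒜₀`. -/
def x0 : P.A0 := ∑ g : P.G, SmashHopf.e P.α g P.X

/-- `ω ^ i`, for `i` modulo `q`. -/
def ωpow (f : P.F) : ℂ := P.ω ^ f.toAdd.val

lemma ωpow_mul (f f' : P.F) : P.ωpow (f * f') = P.ωpow f * P.ωpow f' := by
  rw [ωpow, toAdd_mul, ZMod.val_add, ← pow_eq_pow_mod _ P.ω_prim.pow_eq_one, pow_add]; rfl

lemma ωpow_one : P.ωpow 1 = 1 := by simp [ωpow]

lemma star_ωpow (f : P.F) : star (P.ωpow f) * P.ωpow f = 1 := by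
  have h : ‖P.ω‖ = 1 := P.ω_prim.norm'_eq_one P.q_prime.ne_zero
  have : ‖P.ωpow f‖ = 1 := by simp [ωpow, h]
  have h2 := Complex.conj_mul' (P.ωpow f)
  rw [this] at h2
  simpa using h2

open scoped Classical in
/-- The linear map with `e_g # f ↦ δ_{g, b} ω ^ f`. -/
def chiLin : Dual ℂ P.A0 :=
  (SmashHopf.basis P.α).constr ℂ fun u => if u.1 = P.b then P.ωpow u.2 else 0

open scoped Classical in
lemma chiLin_e (g : P.G) (f : P.F) :
    P.chiLin (SmashHopf.e P.α g f) = if g = P.b then P.ωpow f else 0 :=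
  (SmashHopf.basis P.α).constr_basis ℂ _ _

/-- The algebra map `χ : 𝒜₀ → ℂ` determined by `χ(e_g) = δ_{g, b}` and `χ(x) = ω`. -/
def χ : P.A0 →ₐ[ℂ] ℂ :=
  AlgHom.ofLinearMap P.chiLin
    (by classical simp [SmashHopf.one_def, chiLin_e, ωpow_one])
    (by
      intro x y
      induction x using (SmashHopf.basis P.α).induction_on' with
      | h0 => simp
      | ha x y hx hy => simp only [hx, hy, add_mul, map_add]
      | hs c x hx => rw [smul_mul_assoc, map_smul, hx, map_smul, smul_mul_assoc]
      | hb u =>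
      induction y using (SmashHopf.basis P.α).induction_on' with
      | h0 => simp
      | ha x y hx hy => simp only [hx, hy, mul_add, map_add]
      | hs c x hx => rw [mul_smul_comm, map_smul, hx, map_smul, mul_smul_comm]
      | hb v =>
      classical
      simp only [SmashHopf.basis_apply, SmashHopf.e_mul_e, apply_ite P.chiLin, map_zero, chiLin_e]
      by_cases hu : u.1 = P.b
      · by_cases hv : v.1 = P.b
        · simp [hu, hv, α_b, ωpow_mul]
        · simp [hu, hv, α_b, Ne.symm hv]
      · simp [hu])

lemma χ_e0 (g : P.G) [Decidable (g = P.b)] : P.χ (P.e0 g) = if g = P.b then 1 else 0 := by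
  rw [← P.ωpow_one]
  refine (P.chiLin_e g 1).trans ?_
  congr

lemma χ_x0 : P.χ P.x0 = P.ω := by
  classical
  have : P.χ P.x0 = P.ωpow P.X := by
    rw [x0, map_sum]
    exact (Finset.sum_congr rfl fun g _ => P.chiLin_e g P.X).trans (by simp)
  rw [this]
  have : (1 : ZMod P.q).val = 1 := ZMod.val_one _
  simp [ωpow, X, this]

/-- The Drinfel'd double `D(𝒜₀)`. -/
abbrev D : Type := Double ℂ P.A0

/-- The element `χ x` of `D(𝒜₀)`. -/
def c : P.D := P.χ.toLinearMap ⊗ₜ P.x0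

lemma chiLin_eq : P.chiLin = ∑ j : P.F, P.ωpow j • SmashHopf.E P.α P.b j := by
  classical
  refine (SmashHopf.basis P.α).ext fun u => ?_
  rw [LinearMap.sum_apply, SmashHopf.basis_apply, chiLin_e]
  by_cases h : u.1 = P.b <;> simp [SmashHopf.E_e, h]

lemma c_eq : P.c = ∑ j : P.F, ∑ u : P.G, P.ωpow j • SmashHopf.B P.α P.b j u P.X := by
  change P.chiLin ⊗ₜ P.x0 = _
  rw [chiLin_eq, x0, TensorProduct.sum_tmul]
  simp only [TensorProduct.tmul_sum, SmashHopf.B, TensorProduct.smul_tmul']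

lemma α_X_inv (g : P.G) : P.α P.X⁻¹ g = P.b⁻¹ * g * P.b := by
  rw [α_apply, map_inv, inv_inv]; rfl

lemma c_mul_B (g h : P.G) (i m : P.F) : P.c * SmashHopf.B P.α g i h m =
    P.ωpow i • SmashHopf.B P.α (g * P.b) i (P.b⁻¹ * h * P.b) (m * P.X) := by
  classical
  rw [c_eq]
  simp only [Finset.sum_mul, smul_mul_assoc, SmashHopf.B_mul_B]
  rw [Finset.sum_eq_single i,
    Finset.sum_eq_single (P.α i (P.α P.X⁻¹ g) * P.α P.X⁻¹ h * (P.α P.X⁻¹ g)⁻¹)]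
  · rw [if_pos ⟨rfl, by group⟩, mul_comm P.X, α_X_inv, α_X_inv]
    simp [mul_assoc]
  · intro v _ hv
    rw [if_neg, smul_zero]
    rintro ⟨-, h2⟩
    exact hv (eq_mul_inv_of_mul_eq h2)
  · simp
  · intro j _ hj
    simp [hj]
  · simp

lemma B_mul_c (g h : P.G) (i m : P.F) : SmashHopf.B P.α g i h m * P.c =
    P.ωpow i • SmashHopf.B P.α (g * P.b) i (P.b⁻¹ * h * P.b) (m * P.X) := by
  classical
  rw [c_eq]
  simp only [Finset.mul_sum, mul_smul_comm, SmashHopf.B_mul_B, α_b]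
  rw [Finset.sum_eq_single i, Finset.sum_eq_single (P.α m (P.b⁻¹ * h * P.b))]
  · rw [if_pos ⟨rfl, by rw [SmashHopf.act_inv_act]; group⟩, SmashHopf.act_inv_act]
  · intro v _ hv
    rw [if_neg, smul_zero]
    rintro ⟨-, h2⟩
    apply hv
    rw [mul_assoc, h2, inv_mul_cancel_left]
    simp
  · simp
  · intro j _ hj
    simp [hj.symm]
  · simp

lemma c_comm (d : P.D) : P.c * d = d * P.c := by
  induction d using SmashHopf.double_induction with
  | h0 => simp
  | ha x y hx hy => simp only [mul_add, add_mul, hx, hy]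
  | hs k x hx => rw [mul_smul_comm, hx, smul_mul_assoc]
  | hb g i h m => rw [c_mul_B, B_mul_c]

lemma c_groupLike : IsGroupLikeElem ℂ P.c where
  counit_eq_one := by
    classical
    rw [c, TensorProduct.counit_tmul, CoopDual.counit_apply, x0, map_sum]
    rw [Finset.sum_eq_single 1 (fun g _ hg => by rw [SmashHopf.counit_e, if_neg hg]) (by simp),
      SmashHopf.counit_e, if_pos rfl]
    simp
  comul_eq_tmul_self := by
    have h1 : comul (R := ℂ) (P.χ.toLinearMap : Dual ℂ P.A0) =
        P.χ.toLinearMap ⊗ₜ[ℂ] P.χ.toLinearMap := by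
      refine CoopDual.ext_dualDistrib fun a b => ?_
      rw [CoopDual.dualDistrib_comul, TensorProduct.dualDistrib_apply]
      simp [mul_comm]
    have h2 : comul (R := ℂ) P.x0 = P.x0 ⊗ₜ[ℂ] P.x0 := by
      simp only [x0, map_sum, SmashHopf.comul_e, TensorProduct.sum_tmul, TensorProduct.tmul_sum]
      rw [Finset.sum_comm]
      conv_rhs => rw [Finset.sum_comm]
      refine Finset.sum_congr rfl fun g _ => ?_
      exact Fintype.sum_equiv (Equiv.mulLeft g⁻¹) _ _ fun h => by simp
    rw [c, TensorProduct.comul_tmul, h1, h2]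
    rfl

lemma c_mul_star : P.c * star P.c = 1 := by
  have h1 : star P.c = ∑ j : P.F, ∑ u : P.G, star (P.ωpow j) •
      SmashHopf.B P.α P.b⁻¹ j (P.b * P.b * u * P.b⁻¹ * P.b⁻¹) P.X⁻¹ := by
    rw [c_eq, star_sum]
    refine Finset.sum_congr rfl fun j _ => ?_
    rw [star_sum]
    refine Finset.sum_congr rfl fun u _ => ?_
    rw [star_smul]
    congr 1
    refine (SmashHopf.starMap_B P.α _ _ _ _).trans ?_
    rw [map_inv, α_b, α_b, α_apply]
    congr 1
    simp only [mul_assoc]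
    rfl
  rw [h1, Finset.mul_sum]
  refine Eq.trans ?_ (SmashHopf.doubleOne_eq P.α).symm
  refine Finset.sum_congr rfl fun j _ => ?_
  rw [Finset.mul_sum]
  refine Fintype.sum_equiv (MulAut.conj P.b).toEquiv _ _ fun u => ?_
  rw [mul_smul_comm, c_mul_B, smul_smul, star_ωpow, one_smul]
  simp [mul_assoc]

/-- The left ideal `I = D(𝒜₀) ⟨χ x⟩⁺`, where `⟨χ x⟩` is the subalgebra generated by the group-like
element `χ x` (its group algebra) and `⟨χ x⟩⁺` is the kernel of the counit on `⟨χ x⟩`. -/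
def I : Ideal P.D :=
  Ideal.span {u | u ∈ Algebra.adjoin ℂ {P.c} ∧ counit (R := ℂ) u = 0}

lemma I_eq : P.I = Ideal.span {P.c - 1} := by
  apply le_antisymm
  · rw [I, Ideal.span_le]
    rintro u ⟨hu, h0⟩
    have key : u - algebraMap ℂ P.D (counit (R := ℂ) u) ∈ Ideal.span {P.c - 1} := by
      clear h0
      induction hu using Algebra.adjoin_induction with
      | mem v hv =>
        rw [Set.mem_singleton_iff] at hv
        subst hv
        rw [P.c_groupLike.counit_eq_one, map_one]
        exact Ideal.subset_span rfl
      | algebraMap r => simp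
      | add v w _ _ hv hw =>
        have := add_mem hv hw
        rw [map_add, map_add]
        convert this using 1
        abel
      | mul v w _ _ hv hw =>
        have h1 := Ideal.mul_mem_left _ v hw
        have h2 := Ideal.mul_mem_left _ (algebraMap ℂ P.D (counit (R := ℂ) w)) hv
        have := add_mem h1 h2
        rw [Bialgebra.counit_mul, map_mul]
        convert this using 1
        rw [mul_sub, mul_sub, Algebra.commutes (counit (R := ℂ) w) v,
          Algebra.commutes (counit (R := ℂ) w) (algebraMap ℂ P.D (counit (R := ℂ) v))]
        abel
    rw [h0, map_zero, sub_zero] at key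
    exact key
  · rw [Ideal.span_le, Set.singleton_subset_iff]
    refine Ideal.subset_span ⟨sub_mem (Algebra.subset_adjoin rfl) (one_mem _), ?_⟩
    rw [map_sub, P.c_groupLike.counit_eq_one, Bialgebra.counit_one, sub_self]

lemma mem_I {u : P.D} : u ∈ P.I ↔ ∃ d, d * (P.c - 1) = u := by
  rw [I_eq, Ideal.mem_span_singleton']

instance : P.I.IsTwoSided where
  mul_mem_of_left := by
    intro u v hu
    obtain ⟨d, rfl⟩ := P.mem_I.1 hu
    refine P.mem_I.2 ⟨d * v, ?_⟩
    rw [mul_assoc, mul_assoc, mul_sub, sub_mul, P.c_comm, mul_one, one_mul]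

lemma c_sub_one_mem : P.c - 1 ∈ P.I := P.mem_I.2 ⟨1, one_mul _⟩

lemma mk_c : Ideal.Quotient.mk P.I P.c = 1 := by
  have := (Ideal.Quotient.eq_zero_iff_mem).2 P.c_sub_one_mem
  rwa [map_sub, map_one, sub_eq_zero] at this

instance : P.I.IsHopfIdeal ℂ where
  counit_eq_zero := by
    intro u hu
    obtain ⟨d, rfl⟩ := P.mem_I.1 hu
    rw [Bialgebra.counit_mul, map_sub, P.c_groupLike.counit_eq_one, Bialgebra.counit_one,
      sub_self, mul_zero]
  map_mkQ_comul_eq_zero := by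
    intro u hu
    obtain ⟨d, rfl⟩ := P.mem_I.1 hu
    change Algebra.TensorProduct.map (Ideal.Quotient.mkₐ ℂ P.I) (Ideal.Quotient.mkₐ ℂ P.I)
      (comul (R := ℂ) (d * (P.c - 1))) = 0
    rw [Bialgebra.comul_mul, map_mul, map_sub, P.c_groupLike.comul_eq_tmul_self,
      Bialgebra.comul_one, map_sub, map_one, Algebra.TensorProduct.map_tmul,
      Ideal.Quotient.mkₐ_eq_mk, mk_c, Algebra.TensorProduct.one_def, sub_self, mul_zero]
  antipode_mem := by
    intro u hu
    obtain ⟨d, rfl⟩ := P.mem_I.1 hu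
    rw [antipode_mul_antidistrib]
    refine Ideal.IsTwoSided.mul_mem_of_left _ ?_
    refine P.mem_I.2 ⟨-antipode ℂ P.c, ?_⟩
    rw [map_sub, antipode_one, mul_sub, neg_mul, P.c_groupLike.antipode_mul_cancel]
    simp [sub_eq_add_neg, add_comm]

lemma star_mem_I {u : P.D} (hu : u ∈ P.I) : star u ∈ P.I := by
  obtain ⟨d, rfl⟩ := P.mem_I.1 hu
  rw [star_mul]
  refine Ideal.IsTwoSided.mul_mem_of_left _ ?_
  refine P.mem_I.2 ⟨-star P.c, ?_⟩
  rw [star_sub, star_one, neg_mul, mul_sub, ← P.c_comm, P.c_mul_star]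
  simp

/-- The Hopf algebra `A_{p,q} = D(𝒜₀) / I`. -/
abbrev A : Type := P.D ⧸ P.I

/-- The involution of `A_{p,q}` is induced by that of `D(𝒜₀)`. -/
instance : StarRing P.A where
  star := Submodule.mapQ (P.I.restrictScalars ℂ) (P.I.restrictScalars ℂ) (Double.starMap P.A0)
    fun _ hu => P.star_mem_I hu
  star_involutive x := by
    obtain ⟨x, rfl⟩ := Ideal.Quotient.mk_surjective x
    exact congrArg (Ideal.Quotient.mk P.I) (star_star x)
  star_mul x y := by
    obtain ⟨x, rfl⟩ := Ideal.Quotient.mk_surjective x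
    obtain ⟨y, rfl⟩ := Ideal.Quotient.mk_surjective y
    exact congrArg (Ideal.Quotient.mk P.I) (star_mul x y)
  star_add x y := by
    obtain ⟨x, rfl⟩ := Ideal.Quotient.mk_surjective x
    obtain ⟨y, rfl⟩ := Ideal.Quotient.mk_surjective y
    exact congrArg (Ideal.Quotient.mk P.I) (star_add x y)

lemma star_mk (d : P.D) :
    star (Ideal.Quotient.mk P.I d) = Ideal.Quotient.mk P.I (star d) := rfl

instance : StarModule ℂ P.A where
  star_smul k x := by
    obtain ⟨x, rfl⟩ := Ideal.Quotient.mk_surjective x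
    exact congrArg (Ideal.Quotient.mk P.I) (star_smul k x)

/-- The image in `A_{p,q}` of the element `f ⊗ h` of `D(𝒜₀)`. -/
def mkA (f : Dual ℂ P.A0) (h : P.A0) : P.A := Ideal.Quotient.mk P.I (f ⊗ₜ h)

/-- The class of `x ∈ 𝒜₀` (the counit is the unit of the dual). -/
def x : P.A := P.mkA counit P.x0

/-- The class of `e_g ∈ 𝒜₀`. -/
def e (g : P.G) : P.A := P.mkA counit (P.e0 g)

/-- The class of `Y = ∑_j E_{a; x ^ j}`. -/
def y : P.A := P.mkA (∑ f : P.F, SmashHopf.E P.α P.a f) 1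

/-- The class of `Z_i = E_{1; x ^ i}`; the index `i` is taken modulo `q`. -/
def z (i : ZMod P.q) : P.A := P.mkA (SmashHopf.E P.α 1 (Multiplicative.ofAdd i)) 1

/-- The names of the generators. -/
inductive Gen
  | x
  | y
  | z (i : ZMod P.q)
  | e (g : P.G)

/-- The generators of the free algebra on the names. -/
def free (s : P.Gen) : FreeAlgebra ℂ P.Gen := FreeAlgebra.ι ℂ s

/-- The defining relations. -/
inductive Rel : FreeAlgebra ℂ P.Gen → FreeAlgebra ℂ P.Gen → Prop
  | y_x : Rel (P.free .y * P.free .x) (P.free .x * P.free .y ^ P.t)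
  | z_x (i : ZMod P.q) : Rel (P.free (.z i) * P.free .x) (P.free .x * P.free (.z i))
  | e_x (g : P.G) : Rel (P.free (.e g) * P.free .x) (P.free .x * P.free (.e (P.ract g 1)))
  | z_y (i : ZMod P.q) : Rel (P.free (.z i) * P.free .y) (P.free .y * P.free (.z i))
  | e_y (g : P.G) : Rel (P.free (.e g) * P.free .y)
      (P.free .y * ∑ i : ZMod P.q, P.free (.z i) * P.free (.e (P.ract P.a⁻¹ i * g * P.a)))
  | e_z (g : P.G) (i : ZMod P.q) : Rel (P.free (.e g) * P.free (.z i)) (P.free (.z i) * P.free (.e g))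
  | x_pow : Rel (P.free .x ^ P.q) 1
  | y_pow : Rel (P.free .y ^ P.p) 1
  | z_z (i j : ZMod P.q) :
      Rel (P.free (.z i) * P.free (.z j)) (if i = j then P.free (.z i) else 0)
  | e_e (g h : P.G) : Rel (P.free (.e g) * P.free (.e h)) (if g = h then P.free (.e g) else 0)
  | sum_z : Rel (∑ i : ZMod P.q, P.free (.z i)) 1
  | sum_e : Rel (∑ g : P.G, P.free (.e g)) 1

/-- The unital associative `ℂ`-algebra presented by the generators `x`, `y`, `z_i`, `e_g` and the
defining relations. -/
abbrev Presented : Type := RingQuot P.Rel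

/-- The generators of the presented algebra. -/
def presentedGen (s : P.Gen) : P.Presented := RingQuot.mkAlgHom ℂ P.Rel (P.free s)

/-- The elements of `A_{p,q}` corresponding to the names of the generators. -/
def gen : P.Gen → P.A
  | .x => P.x
  | .y => P.y
  | .z i => P.z i
  | .e g => P.e g

end Datum

/-- `A` (a Hopf algebra over `ℂ` with an antimultiplicative conjugate-linear involution) is a
`C^*`-Hopf algebra: a semisimple Hopf `*`-algebra whose underlying `*`-algebra is a
`C^*`-algebra. -/
structure IsCStarHopfAlgebra (A : Type) [Ring A] [HopfAlgebra ℂ A] [StarRing A]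
    [StarModule ℂ A] : Prop where
  comul_star : ∀ a : A, comul (R := ℂ) (star a) = star (comul (R := ℂ) a)
  counit_star : ∀ a : A, counit (R := ℂ) (star a) = star (counit (R := ℂ) a)
  antipode_star : ∀ a : A, antipode ℂ (star (antipode ℂ (star a))) = a
  semisimple : IsSemisimpleRing A
  cstar : ∃ (C : Type) (_ : CStarAlgebra C), Nonempty (A ≃⋆ₐ[ℂ] C)

end

/-!
`A_{p,q}` as the algebra of a finite groupoid, and its presentation.

In the basis `E_{g; i} ⊗ (e_h # m)` of the double, a product of two basis elements is a basis
element or zero, and the involution permutes the basis: the double is the convolution `*`-algebra of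
a finite groupoid. The group-like element `χ x` is central and, up to a power of `ω`, sends the index
`(g, i, h, m)` to `(g b, i, b⁻¹ h b, m x)`; so in the quotient the `⟨b⟩`-component of `g` can be removed, and the
classes with `g ∈ ⟨a⟩` span. A linear map on the double which carries out this normalization kills
`I`, hence these classes form a basis (`Datum.basisA`). They are again closed under multiplication
(up to zero) and involution.

*`C^*`-structure.* The functional that sums the coefficients at the identity arrows of this groupoid
makes the basis orthonormal for `(u, v) ↦ φ (u^* v)` (`Datum.functional_star_mul`), so left
multiplication is a faithful `*`-representation by matrices. Semisimplicity follows: `u^* u` is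
self-adjoint, and nilpotent for `u` in the Jacobson radical, hence zero.

*Presentation.* An element of `A_{p,q}` is determined by its left multiplication on the classes of
basis elements (`Datum.ext_mul_cls`), on which the generators act by shifts (`x`, `y`) and by
projections (`z_i`, `e_g`); the relations are read off from these actions. Conversely, the relations
allow every word to be rewritten as a combination of the monomials `y ^ n z_i e_h x ^ m`
(`Datum.monomialSpan_eq_top`), which the map to `A_{p,q}` sends bijectively to the basis
(`Datum.ofPresented_monomial`).

The Hopf structure on the generators is the sum over basis elements of the formulas in the double.
-/

noncomputable section

open Module Coalgebra HopfAlgebra DrinfeldDouble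

/-! ### Finite-dimensional `*`-algebras inside a `C^*`-algebra -/

section CStar

/-- Via an injective `*`-homomorphism to a finite-dimensional `C^*`-algebra: the range is
automatically closed. -/
lemma exists_cstarAlgebra_equiv_of_injective {A B : Type} [Ring A] [Algebra ℂ A] [StarRing A]
    [StarModule ℂ A] [CStarAlgebra B] [FiniteDimensional ℂ B] (f : A →⋆ₐ[ℂ] B)
    (hf : Function.Injective f) :
    ∃ (C : Type) (_ : CStarAlgebra C), Nonempty (A ≃⋆ₐ[ℂ] C) := by
  have h_closed : IsClosed (f.range : Set B) :=
    Submodule.closed_of_finiteDimensional (Subalgebra.toSubmodule f.range.toSubalgebra)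
  exact ⟨f.range, StarSubalgebra.cstarAlgebra f.range, ⟨StarAlgEquiv.ofInjective f hf⟩⟩

/-- A self-adjoint element of a `C^*`-algebra satisfies `‖x ^ 2 ^ n‖ = ‖x‖ ^ 2 ^ n`. -/
lemma IsSelfAdjoint.eq_zero_of_isNilpotent {B : Type*} [CStarAlgebra B] {x : B}
    (hx : IsSelfAdjoint x) (hn : IsNilpotent x) : x = 0 := by
  obtain ⟨n, hn⟩ := hn
  have h : x ^ 2 ^ n = 0 := pow_eq_zero_of_le Nat.lt_two_pow_self.le hn
  have h2 := hx.nnnorm_pow_two_pow n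
  rw [h, nnnorm_zero] at h2
  exact nnnorm_eq_zero.1 (pow_eq_zero_iff (by positivity) |>.1 h2.symm)

/-- If `x` lies in the Jacobson radical, then `x^* x` is self-adjoint and nilpotent, so `x = 0`. -/
lemma isSemisimpleRing_of_starAlgEquiv {A C : Type*} [Ring A] [Algebra ℂ A] [StarRing A]
    [IsArtinianRing A] [CStarAlgebra C] (f : A ≃⋆ₐ[ℂ] C) : IsSemisimpleRing A := by
  rw [IsArtinianRing.isSemisimpleRing_iff_jacobson, eq_bot_iff]
  intro x hx
  obtain ⟨n, hn⟩ := IsArtinianRing.isNilpotent_jacobson_bot (R := A)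
  rw [Ideal.jacobson_bot] at hn
  have h1 : star x * x ∈ Ring.jacobson A := Ideal.mul_mem_left _ _ hx
  have h2 : IsNilpotent (star x * x) := by
    refine ⟨n, ?_⟩
    have := Ideal.pow_mem_pow h1 n
    rwa [hn] at this
  have h3 : IsNilpotent (star (f x) * f x) := by
    have := h2.map f
    rwa [map_mul, map_star] at this
  have h4 : f x = 0 := CStarRing.star_mul_self_eq_zero_iff _ |>.1
    ((IsSelfAdjoint.star_mul_self (f x)).eq_zero_of_isNilpotent h3)
  exact (map_eq_zero_iff f f.injective).1 h4

open scoped ComplexOrder in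
/-- A `*`-algebra with a hermitian functional `φ` and a finite basis that is orthonormal for the
form `(x, y) ↦ φ (x^* y)` embeds into a matrix algebra: left multiplication by `x^*` is the adjoint
of left multiplication by `x`. -/
lemma exists_cstarAlgebra_equiv_of_orthonormal {A ι : Type} [Ring A] [Algebra ℂ A] [StarRing A]
    [StarModule ℂ A] [Fintype ι] [DecidableEq ι] (v : Basis ι ℂ A) (φ : A →ₗ[ℂ] ℂ)
    (hstar : ∀ x, φ (star x) = star (φ x))
    (hv : ∀ r s, φ (star (v r) * v s) = if r = s then 1 else 0) :
    ∃ (C : Type) (_ : CStarAlgebra C), Nonempty (A ≃⋆ₐ[ℂ] C) := by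
  have hrepr : ∀ x r, v.repr x r = φ (star (v r) * x) := by
    intro x r
    conv_rhs => rw [← v.sum_repr x, Finset.mul_sum, map_sum]
    simp [hv]
  let f : A →⋆ₐ[ℂ] Matrix ι ι ℂ :=
    { Algebra.leftMulMatrix v with
      map_star' := fun x => by
        ext r s
        change Algebra.leftMulMatrix v (star x) r s = (star (Algebra.leftMulMatrix v x)) r s
        rw [Matrix.star_apply, Algebra.leftMulMatrix_eq_repr_mul, Algebra.leftMulMatrix_eq_repr_mul,
          hrepr, hrepr, ← hstar]
        simp [mul_assoc] }
  have hf : Function.Injective f := Algebra.leftMulMatrix_injective v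
  have : FiniteDimensional ℂ (CStarMatrix ι ι ℂ) :=
    (CStarMatrix.ofMatrixStarAlgEquiv (n := ι) (A := ℂ)).toAlgEquiv.toLinearEquiv.finiteDimensional
  refine exists_cstarAlgebra_equiv_of_injective
    (((CStarMatrix.ofMatrixStarAlgEquiv : Matrix ι ι ℂ ≃⋆ₐ[ℂ] _) :
      Matrix ι ι ℂ →⋆ₐ[ℂ] CStarMatrix ι ι ℂ).comp f) ?_
  exact (CStarMatrix.ofMatrixStarAlgEquiv (n := ι) (A := ℂ)).injective.comp hf

end CStar

namespace Datum

variable (P : Datum)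

/-! ### Multiplication in the quotient -/

/-- The class in `A_{p,q}` of the basis element `E_{g; i} ⊗ (e_h # m)` of the double. -/
def cls (g : P.G) (i : P.F) (h : P.G) (m : P.F) : P.A :=
  Ideal.Quotient.mk P.I (SmashHopf.B P.α g i h m)

lemma mk_sum {ι : Type*} (s : Finset ι) (f : ι → P.D) :
    Ideal.Quotient.mk P.I (∑ r ∈ s, f r) = ∑ r ∈ s, Ideal.Quotient.mk P.I (f r) := map_sum _ _ _

lemma mk_smul (c : ℂ) (d : P.D) :
    Ideal.Quotient.mk P.I (c • d) = c • Ideal.Quotient.mk P.I d := rfl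

lemma induction_cls {Q : P.A → Prop} (u : P.A) (h0 : Q 0) (ha : ∀ u v, Q u → Q v → Q (u + v))
    (hs : ∀ (c : ℂ) u, Q u → Q (c • u)) (hb : ∀ g i h m, Q (P.cls g i h m)) : Q u := by
  obtain ⟨u, rfl⟩ := Ideal.Quotient.mk_surjective u
  induction u using SmashHopf.double_induction with
  | h0 => rw [map_zero]; exact h0
  | ha x y hx hy => rw [map_add]; exact ha _ _ hx hy
  | hs c x hx => rw [mk_smul]; exact hs _ _ hx
  | hb g i h m => exact hb g i h m

lemma cls_mul_cls (g h g' k : P.G) (i m j n : P.F) :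
    P.cls g i h m * P.cls g' j k n =
      if i = j ∧ h * P.α m⁻¹ g' = P.α i (P.α m⁻¹ g') * P.α m⁻¹ k then
        P.cls (g * P.α m⁻¹ g') i (P.α m⁻¹ k) (m * n) else 0 := by
  rw [cls, cls, ← map_mul, SmashHopf.B_mul_B, apply_ite (Ideal.Quotient.mk P.I), map_zero]
  simp only [cls]
  congr

lemma one_eq_sum_cls : (1 : P.A) = ∑ i : P.F, ∑ h : P.G, P.cls 1 i h 1 := by
  rw [← map_one (Ideal.Quotient.mk P.I)]
  have : (1 : P.D) = _ := SmashHopf.doubleOne_eq P.α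
  rw [this]
  simp only [mk_sum, cls]

/-- An element is determined by its left multiplication on the spanning family. -/
lemma ext_mul_cls {u v : P.A} (huv : ∀ g i h m, u * P.cls g i h m = v * P.cls g i h m) : u = v := by
  rw [← mul_one u, ← mul_one v, one_eq_sum_cls]
  simp only [Finset.mul_sum, huv]

lemma star_cls (g h : P.G) (i m : P.F) : star (P.cls g i h m) =
    P.cls (P.α m g⁻¹) i (P.α m (P.α i g * h * g⁻¹)) m⁻¹ := by
  rw [cls, star_mk]
  exact congrArg (Ideal.Quotient.mk P.I) (SmashHopf.starMap_B P.α g h i m)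

lemma antipode_cls (g h : P.G) (i m : P.F) : antipode ℂ (P.cls g i h m) =
    P.cls (P.α m (P.α i g))⁻¹ i⁻¹ (P.α m (P.α i g * h * g⁻¹))⁻¹ m⁻¹ := by
  rw [cls, HopfAlgebra.Quotient.antipode_mk, SmashHopf.antipode_B]
  rfl

lemma counit_cls (g h : P.G) (i m : P.F) :
    counit (R := ℂ) (P.cls g i h m) = if i = 1 ∧ h = 1 then 1 else 0 := by
  rw [cls, Bialgebra.Quotient.counit_mk, SmashHopf.counit_B]
  congr

lemma comul_cls (g h : P.G) (i m : P.F) : comul (R := ℂ) (P.cls g i h m) =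
    ∑ j : P.F, ∑ u : P.G,
      P.cls (P.α j g) (i * j⁻¹) u m ⊗ₜ[ℂ] P.cls g j (u⁻¹ * h) m := by
  rw [cls, Bialgebra.Quotient.comul_mk, SmashHopf.comul_B]
  simp only [map_sum]
  rfl

/-! ### The families of elements containing the generators -/

/-- The class of `1 # f`, multiplicative in `f`. -/
def xF (f : P.F) : P.A := ∑ i : P.F, ∑ h : P.G, P.cls 1 i h f

/-- The class of `∑_j E_{g; x ^ j}`, multiplicative in `g`. -/
def yG (g : P.G) : P.A := ∑ i : P.F, ∑ h : P.G, P.cls g i h 1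

/-- The class of `E_{g; f}`. -/
def dualCls (g : P.G) (f : P.F) : P.A := ∑ h : P.G, P.cls g f h 1

lemma mkA_E (g : P.G) (f : P.F) : P.mkA (SmashHopf.E P.α g f) 1 = P.dualCls g f := by
  rw [mkA, SmashHopf.one_def, TensorProduct.tmul_sum, mk_sum]
  rfl

lemma mkA_counit_e (g : P.G) (f : P.F) :
    P.mkA counit (SmashHopf.e P.α g f) = ∑ i : P.F, P.cls 1 i g f := by
  rw [mkA, SmashHopf.counit_eq_sum, TensorProduct.sum_tmul, mk_sum]
  rfl

lemma x_eq : P.x = P.xF P.X := by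
  rw [x, x0, mkA, TensorProduct.tmul_sum, mk_sum, xF, Finset.sum_comm]
  exact Finset.sum_congr rfl fun h _ => P.mkA_counit_e h P.X

lemma y_eq : P.y = P.yG P.a := by
  rw [y, mkA, TensorProduct.sum_tmul, mk_sum, yG]
  exact Finset.sum_congr rfl fun i _ => P.mkA_E P.a i

lemma z_eq (i : ZMod P.q) : P.z i = P.dualCls 1 (Multiplicative.ofAdd i) := P.mkA_E _ _

lemma e_eq (g : P.G) : P.e g = ∑ i : P.F, P.cls 1 i g 1 := P.mkA_counit_e _ _

lemma xF_mul_cls (f : P.F) (g h : P.G) (i m : P.F) :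
    P.xF f * P.cls g i h m = P.cls (P.α f⁻¹ g) i (P.α f⁻¹ h) (f * m) := by
  simp only [xF, Finset.sum_mul, cls_mul_cls]
  rw [Finset.sum_eq_single i, Finset.sum_eq_single (P.α i (P.α f⁻¹ g) * P.α f⁻¹ h * (P.α f⁻¹ g)⁻¹)]
  · simp
  · intro v _ hv
    rw [if_neg]
    rintro ⟨-, h2⟩
    exact hv (eq_mul_inv_of_mul_eq h2)
  · simp
  · intro j _ hj
    simp [hj]
  · simp

lemma dualCls_mul_cls (g' : P.G) (j : P.F) (g h : P.G) (i m : P.F) :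
    P.dualCls g' j * P.cls g i h m = if j = i then P.cls (g' * g) i h m else 0 := by
  simp only [dualCls, Finset.sum_mul, cls_mul_cls]
  rw [Finset.sum_eq_single (P.α i g * h * g⁻¹)]
  · by_cases hj : j = i <;> simp [hj]
  · intro v _ hv
    rw [if_neg]
    rintro ⟨rfl, h2⟩
    refine hv (eq_mul_inv_of_mul_eq ?_)
    simpa using h2
  · simp

lemma yG_eq_sum (g : P.G) : P.yG g = ∑ i : P.F, P.dualCls g i := rfl

lemma yG_mul_cls (g' g h : P.G) (i m : P.F) :
    P.yG g' * P.cls g i h m = P.cls (g' * g) i h m := by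
  simp [yG_eq_sum, Finset.sum_mul, dualCls_mul_cls]

lemma e_mul_cls (u g h : P.G) (i m : P.F) :
    P.e u * P.cls g i h m = if u * g = P.α i g * h then P.cls g i h m else 0 := by
  simp only [e_eq, Finset.sum_mul, cls_mul_cls]
  rw [Finset.sum_eq_single i]
  · simp
  · intro j _ hj
    simp [hj]
  · simp

lemma z_mul_cls (j : ZMod P.q) (g h : P.G) (i m : P.F) :
    P.z j * P.cls g i h m = if Multiplicative.ofAdd j = i then P.cls g i h m else 0 := by
  rw [z_eq, dualCls_mul_cls, one_mul]

lemma x_mul_cls (g h : P.G) (i m : P.F) :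
    P.x * P.cls g i h m = P.cls (P.α P.X⁻¹ g) i (P.α P.X⁻¹ h) (P.X * m) := by
  rw [x_eq, xF_mul_cls]

lemma y_mul_cls (g h : P.G) (i m : P.F) : P.y * P.cls g i h m = P.cls (P.a * g) i h m := by
  rw [y_eq, yG_mul_cls]

lemma xF_mul (f f' : P.F) : P.xF (f * f') = P.xF f * P.xF f' := by
  refine P.ext_mul_cls fun g i h m => ?_
  simp only [mul_assoc, xF_mul_cls]
  rw [← MulAut.mul_apply, ← MulAut.mul_apply, ← map_mul, mul_inv]

lemma xF_one : P.xF 1 = 1 := P.ext_mul_cls fun g i h m => by simp [xF_mul_cls]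

lemma yG_mul (g g' : P.G) : P.yG (g * g') = P.yG g * P.yG g' :=
  P.ext_mul_cls fun _ _ _ _ => by simp only [mul_assoc, yG_mul_cls]

lemma yG_one : P.yG 1 = 1 := P.ext_mul_cls fun g i h m => by simp [yG_mul_cls]

lemma xF_pow (f : P.F) (n : ℕ) : P.xF f ^ n = P.xF (f ^ n) := by
  induction n with
  | zero => rw [pow_zero, pow_zero, xF_one]
  | succ n ih => rw [pow_succ, pow_succ, xF_mul, ih]

lemma yG_pow (g : P.G) (n : ℕ) : P.yG g ^ n = P.yG (g ^ n) := by
  induction n with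
  | zero => rw [pow_zero, pow_zero, yG_one]
  | succ n ih => rw [pow_succ, pow_succ, yG_mul, ih]

lemma inverse_x : Ring.inverse P.x = P.xF P.X⁻¹ := by
  rw [x_eq]
  exact Ring.inverse_unit (⟨P.xF P.X, P.xF P.X⁻¹, by rw [← xF_mul, mul_inv_cancel, xF_one],
    by rw [← xF_mul, inv_mul_cancel, xF_one]⟩ : P.Aˣ)

lemma inverse_y : Ring.inverse P.y = P.yG P.a⁻¹ := by
  rw [y_eq]
  exact Ring.inverse_unit (⟨P.yG P.a, P.yG P.a⁻¹, by rw [← yG_mul, mul_inv_cancel, yG_one],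
    by rw [← yG_mul, inv_mul_cancel, yG_one]⟩ : P.Aˣ)

lemma dualCls_eq (g : P.G) (f : P.F) : P.dualCls g f = P.yG g * P.z f.toAdd := by
  refine P.ext_mul_cls fun g' i h m => ?_
  rw [dualCls_mul_cls, mul_assoc, z_mul_cls, mul_ite, mul_zero, yG_mul_cls]
  rfl

/-! ### The defining relations -/

lemma X_pow : P.X ^ P.q = 1 := by
  rw [X, ← ofAdd_nsmul]; simp

lemma α_X_inv_a_pow : P.α P.X⁻¹ (P.a ^ P.t) = P.a := by
  rw [← b_mul_a, α_X_inv]; group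

lemma y_mul_x : P.y * P.x = P.x * P.y ^ P.t := by
  refine P.ext_mul_cls fun g i h m => ?_
  rw [y_eq, yG_pow]
  simp only [mul_assoc, x_mul_cls, yG_mul_cls, map_mul, α_X_inv_a_pow]

lemma z_mul_x (j : ZMod P.q) : P.z j * P.x = P.x * P.z j := by
  refine P.ext_mul_cls fun g i h m => ?_
  simp only [mul_assoc, x_mul_cls, z_mul_cls, mul_ite, mul_zero]

lemma e_mul_x (u : P.G) : P.e u * P.x = P.x * P.e (P.ract u 1) := by
  refine P.ext_mul_cls fun g i h m => ?_
  simp only [mul_assoc, x_mul_cls, e_mul_cls, mul_ite, mul_zero]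
  congr 1
  rw [eq_iff_iff, ← (P.α P.X).injective.eq_iff, map_mul, map_mul, SmashHopf.act_comm P.α i]
  have h1 : ∀ v, P.α P.X (P.α P.X⁻¹ v) = v := fun v => by simp
  rw [h1, h1, h1]
  rfl

lemma z_mul_y (j : ZMod P.q) : P.z j * P.y = P.y * P.z j := by
  refine P.ext_mul_cls fun g i h m => ?_
  simp only [mul_assoc, y_mul_cls, z_mul_cls, mul_ite, mul_zero]

lemma e_mul_y (u : P.G) : P.e u * P.y =
    P.y * ∑ i : ZMod P.q, P.z i * P.e (P.ract P.a⁻¹ i * u * P.a) := by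
  refine P.ext_mul_cls fun g i h m => ?_
  obtain ⟨i, rfl⟩ := Multiplicative.ofAdd.surjective i
  simp only [mul_assoc, Finset.sum_mul, e_mul_cls, mul_ite, mul_zero, z_mul_cls, y_mul_cls]
  rw [Finset.sum_eq_single i]
  · rw [mul_ite, if_pos rfl, y_mul_cls, mul_zero]
    congr 1
    rw [ract, map_inv, map_mul, inv_mul_eq_iff_eq_mul, mul_assoc]
  · intro j _ hj
    simp [hj]
  · simp

lemma e_mul_z (u : P.G) (j : ZMod P.q) : P.e u * P.z j = P.z j * P.e u := by
  refine P.ext_mul_cls fun g i h m => ?_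
  simp only [mul_assoc, e_mul_cls, z_mul_cls, mul_ite, mul_zero]
  split_ifs <;> rfl

lemma x_pow_q : P.x ^ P.q = 1 := by rw [x_eq, xF_pow, X_pow, xF_one]

lemma y_pow_p : P.y ^ P.p = 1 := by rw [y_eq, yG_pow, a_pow, yG_one]

lemma z_mul_z (i j : ZMod P.q) : P.z i * P.z j = if i = j then P.z i else 0 := by
  refine P.ext_mul_cls fun g k h m => ?_
  rw [mul_assoc, z_mul_cls, mul_ite, mul_zero, ite_mul, zero_mul, z_mul_cls]
  by_cases hi : i = j
  · subst hi; split_ifs <;> simp_all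
  · rw [if_neg hi]
    by_cases hj : Multiplicative.ofAdd j = k
    · rw [if_pos hj, if_neg]
      rintro rfl
      exact hi (Multiplicative.ofAdd.injective hj.symm)
    · rw [if_neg hj]

lemma e_mul_e (u v : P.G) : P.e u * P.e v = if u = v then P.e u else 0 := by
  refine P.ext_mul_cls fun g k h m => ?_
  rw [mul_assoc, e_mul_cls, mul_ite, mul_zero, ite_mul, zero_mul, e_mul_cls]
  by_cases hi : u = v
  · subst hi; split_ifs <;> simp_all
  · rw [if_neg hi]
    by_cases hj : v * g = P.α k g * h
    · rw [if_pos hj, if_neg]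
      rw [← hj]
      exact fun h => hi (mul_right_cancel h)
    · rw [if_neg hj]

lemma sum_z : ∑ i : ZMod P.q, P.z i = 1 := by
  rw [← yG_one, yG_eq_sum]
  exact Fintype.sum_equiv Multiplicative.ofAdd _ _ fun i => P.z_eq i

lemma sum_e : ∑ g : P.G, P.e g = 1 := by
  rw [one_eq_sum_cls, Finset.sum_comm]
  exact Finset.sum_congr rfl fun g _ => P.e_eq g

/-! ### A basis of the quotient -/

/-- The bicharacter `(x ^ i, x ^ j) ↦ ω ^ (i j)` of `F`. -/
def ωpair (i s : P.F) : ℂ := P.ωpow (Multiplicative.ofAdd (i.toAdd * s.toAdd))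

lemma ωpair_mul (i s s' : P.F) : P.ωpair i (s * s') = P.ωpair i s * P.ωpair i s' := by
  rw [ωpair, ωpair, ωpair, ← ωpow_mul, toAdd_mul, mul_add, ofAdd_add]

lemma ωpair_one (i : P.F) : P.ωpair i 1 = 1 := by simp [ωpair, ωpow_one]

lemma ωpair_X (i : P.F) : P.ωpair i P.X = P.ωpow i := by simp [ωpair, X]

lemma ωpair_X_inv_mul (i : P.F) : P.ωpair i P.X⁻¹ * P.ωpow i = 1 := by
  rw [← ωpair_X, ← ωpair_mul, inv_mul_cancel, ωpair_one]

lemma cls_mul_b (g h : P.G) (i m : P.F) : P.cls g i h m =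
    P.ωpow i • P.cls (g * P.b) i (P.b⁻¹ * h * P.b) (m * P.X) := by
  rw [cls, cls, ← mk_smul, ← B_mul_c, map_mul, mk_c, mul_one]

/-- Modulo `χ x - 1`, the component of `g` in `⟨b⟩` can be moved to the other indices. -/
lemma cls_mul_inr (g h : P.G) (i m s : P.F) : P.cls g i h m = P.ωpair i s •
    P.cls (g * SemidirectProduct.inr s) i
      ((SemidirectProduct.inr s)⁻¹ * h * SemidirectProduct.inr s) (m * s) := by
  have key : ∀ n : ℕ, P.cls g i h m = P.ωpair i (P.X ^ n) •
      P.cls (g * P.b ^ n) i ((P.b ^ n)⁻¹ * h * P.b ^ n) (m * P.X ^ n) := by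
    intro n
    induction n with
    | zero => simp [ωpair_one]
    | succ n ih =>
      rw [ih, P.cls_mul_b (g * P.b ^ n), smul_smul, pow_succ P.X, ωpair_mul, ωpair_X, pow_succ,
        mul_inv_rev]
      simp only [mul_assoc]
  obtain ⟨s, rfl⟩ := Multiplicative.ofAdd.surjective s
  have h1 : P.X ^ s.val = Multiplicative.ofAdd s := by
    rw [X, ← ofAdd_nsmul]; simp
  have := key s.val
  rwa [← inr_val, h1] at this

/-- The indices `(l, i, h, m)` of the basis elements `E_{a ^ l; x ^ i} ⊗ (e_h # x ^ m)` whose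
classes form a basis of `A_{p,q}`. -/
abbrev Idx : Type := Multiplicative (ZMod P.p) × P.F × P.G × P.F

/-- The class of `E_{a ^ l; x ^ i} ⊗ (e_h # x ^ m)`. -/
def clsIdx (r : P.Idx) : P.A := P.cls (SemidirectProduct.inl r.1) r.2.1 r.2.2.1 r.2.2.2

/-- The coordinates in the family `clsIdx`, as a linear map on the double. -/
def coordD : P.D →ₗ[ℂ] P.Idx →₀ ℂ :=
  (SmashHopf.dbasis P.α).constr ℂ fun u => Finsupp.single
    (u.1.1.left, u.1.2, SemidirectProduct.inr u.1.1.right * u.2.1 *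
      (SemidirectProduct.inr u.1.1.right)⁻¹, u.2.2 * u.1.1.right⁻¹)
    (P.ωpair u.1.2 u.1.1.right⁻¹)

lemma coordD_B (g h : P.G) (i m : P.F) : P.coordD (SmashHopf.B P.α g i h m) = Finsupp.single
    (g.left, i, SemidirectProduct.inr g.right * h * (SemidirectProduct.inr g.right)⁻¹,
      m * g.right⁻¹) (P.ωpair i g.right⁻¹) := by
  have := (SmashHopf.dbasis P.α).constr_basis ℂ (fun u => Finsupp.single
    ((u.1.1.left, u.1.2, SemidirectProduct.inr u.1.1.right * u.2.1 *
      (SemidirectProduct.inr u.1.1.right)⁻¹, u.2.2 * u.1.1.right⁻¹) : P.Idx)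
    (P.ωpair u.1.2 u.1.1.right⁻¹)) ((g, i), (h, m))
  rwa [SmashHopf.dbasis_apply] at this

lemma coordD_mul_c (d : P.D) : P.coordD (d * P.c) = P.coordD d := by
  induction d using SmashHopf.double_induction with
  | h0 => simp
  | ha x y hx hy => simp only [add_mul, map_add, hx, hy]
  | hs k x hx => rw [smul_mul_assoc, map_smul, map_smul, hx]
  | hb g i h m =>
    rw [B_mul_c, map_smul, coordD_B, coordD_B, Finsupp.smul_single]
    have hl : (g * P.b).left = g.left := by simp [b]
    have hr : (g * P.b).right = g.right * P.X := by simp [b, X]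
    have hb : (SemidirectProduct.inr P.X : P.G) = P.b := rfl
    have hω : P.ωpow i * P.ωpair i (g.right * P.X)⁻¹ = P.ωpair i g.right⁻¹ := by
      rw [mul_inv, ωpair_mul, mul_comm, mul_assoc, ωpair_X_inv_mul, mul_one]
    rw [hl, hr, map_mul, hb, smul_eq_mul, hω]
    congr 4
    · simp [mul_assoc]
    · rw [mul_inv, mul_comm g.right⁻¹, mul_assoc, mul_inv_cancel_left]

lemma coordD_of_mem {d : P.D} (hd : d ∈ P.I) : P.coordD d = 0 := by
  obtain ⟨d, rfl⟩ := P.mem_I.1 hd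
  rw [mul_sub, mul_one, map_sub, coordD_mul_c, sub_self]

/-- The coordinates in the family `clsIdx`. -/
def coord : P.A →ₗ[ℂ] P.Idx →₀ ℂ :=
  Submodule.liftQ (P.I.restrictScalars ℂ) P.coordD fun _ hd => P.coordD_of_mem hd

lemma coord_cls (g h : P.G) (i m : P.F) : P.coord (P.cls g i h m) = Finsupp.single
    (g.left, i, SemidirectProduct.inr g.right * h * (SemidirectProduct.inr g.right)⁻¹,
      m * g.right⁻¹) (P.ωpair i g.right⁻¹) := P.coordD_B g h i m

/-- The basis of `A_{p,q}` given by the classes of the `E_{a ^ l; x ^ i} ⊗ (e_h # x ^ m)`. -/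
def basisA : Basis P.Idx ℂ P.A := Basis.ofRepr <|
  LinearEquiv.ofLinearMap P.coord (Finsupp.linearCombination ℂ P.clsIdx)
    (by
      refine Finsupp.lhom_ext' fun r => LinearMap.ext_ring ?_
      simp [clsIdx, coord_cls, ωpair_one])
    (by
      refine LinearMap.ext fun u => ?_
      induction u using P.induction_cls with
      | h0 => simp
      | ha u v hu hv => rw [map_add, hu, hv, map_add]
      | hs k u hu => rw [map_smul, hu, map_smul]
      | hb g i h m =>
        rw [LinearMap.comp_apply, coord_cls, Finsupp.linearCombination_single, clsIdx,
          LinearMap.id_apply, P.cls_mul_inr g h i m g.right⁻¹]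
        have hg : g * SemidirectProduct.inr g.right⁻¹ = SemidirectProduct.inl g.left := by
          rw [map_inv, mul_inv_eq_iff_eq_mul, SemidirectProduct.inl_left_mul_inr_right]
        rw [hg, map_inv, inv_inv])

lemma basisA_apply (r : P.Idx) : P.basisA r = P.clsIdx r := by
  rw [Basis.apply_eq_iff]
  change P.coord (P.clsIdx r) = _
  simp [clsIdx, coord_cls, ωpair_one]

instance : Module.Finite ℂ P.A := Module.Finite.of_basis P.basisA

lemma α_inl (f : P.F) (l : Multiplicative (ZMod P.p)) :
    P.α f (SemidirectProduct.inl l) = SemidirectProduct.inl (P.act f l) := by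
  rw [α_apply, SemidirectProduct.inl_aut, map_inv]

/-! ### The `C^*`-structure -/

/-- The positive functional that is `1` on the basis elements with `l = m = 0`, and `0` on the
others. Multiplication and involution make the basis, with zero adjoined, an inverse semigroup (the
arrows of a groupoid); the functional is the sum of the coefficients at the identity arrows. -/
def functional : P.A →ₗ[ℂ] ℂ :=
  P.basisA.constr ℂ fun r => if r.1 = 1 ∧ r.2.2.2 = 1 then 1 else 0

lemma functional_cls_inl (l : Multiplicative (ZMod P.p)) (h : P.G) (i m : P.F) :
    P.functional (P.cls (SemidirectProduct.inl l) i h m) = if l = 1 ∧ m = 1 then 1 else 0 := by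
  have := P.basisA.constr_basis ℂ (fun r => if r.1 = 1 ∧ r.2.2.2 = 1 then (1 : ℂ) else 0)
    (l, i, h, m)
  rwa [basisA_apply] at this

lemma functional_star (u : P.A) : P.functional (star u) = star (P.functional u) := by
  induction u using P.basisA.induction_on' with
  | h0 => simp
  | ha u v hu hv => simp only [star_add, map_add, hu, hv]
  | hs k u hu => rw [star_smul, map_smul, map_smul, hu, star_smul]
  | hb r =>
    rw [basisA_apply, clsIdx, star_cls, ← map_inv, α_inl, functional_cls_inl, functional_cls_inl]
    simp [apply_ite (star : ℂ → ℂ)]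

lemma functional_star_mul (r s : P.Idx) :
    P.functional (star (P.basisA r) * P.basisA s) = if r = s then 1 else 0 := by
  obtain ⟨l, i, h, m⟩ := r
  obtain ⟨l', j, k, n⟩ := s
  rw [basisA_apply, basisA_apply, clsIdx, clsIdx, star_cls, cls_mul_cls, inv_inv]
  simp only [← map_inv SemidirectProduct.inl, α_inl, ← map_mul SemidirectProduct.inl,
    apply_ite P.functional, functional_cls_inl, map_zero, ← map_mul (P.act m),
    map_eq_one_iff _ (P.act m).injective, ← ite_and]
  congr 1
  rw [eq_iff_iff]
  constructor
  · rintro ⟨⟨rfl, h1⟩, h2, h3⟩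
    obtain rfl := inv_mul_eq_one.1 h2
    obtain rfl := inv_mul_eq_one.1 h3
    simp only [← α_inl] at h1
    rw [SmashHopf.act_comm P.α i m, ← map_mul, ← map_mul,
      (P.α m).injective.eq_iff, map_inv, inv_mul_cancel_right, mul_right_inj] at h1
    rw [h1]
  · intro h
    simp only [Prod.mk.injEq] at h
    obtain ⟨rfl, rfl, rfl, rfl⟩ := h
    refine ⟨⟨rfl, ?_⟩, by simp, by simp⟩
    simp only [← α_inl]
    rw [SmashHopf.act_comm P.α i m, ← map_mul, ← map_mul, map_inv,
      inv_mul_cancel_right]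

lemma exists_cstarAlgebra_equiv : ∃ (C : Type) (_ : CStarAlgebra C), Nonempty (P.A ≃⋆ₐ[ℂ] C) :=
  exists_cstarAlgebra_equiv_of_orthonormal P.basisA P.functional P.functional_star
    P.functional_star_mul

lemma comul_star_cls (g h : P.G) (i m : P.F) :
    comul (R := ℂ) (star (P.cls g i h m)) = star (comul (R := ℂ) (P.cls g i h m)) := by
  rw [star_cls, comul_cls, comul_cls, star_sum]
  refine Finset.sum_congr rfl fun j _ => ?_
  rw [star_sum]
  symm
  refine Fintype.sum_equiv
    (((Equiv.mulLeft (P.α i g)).trans (Equiv.mulRight (P.α j g)⁻¹)).trans (P.α m).toEquiv)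
    _ _ fun u => ?_
  have h1 : P.α (i * j⁻¹) (P.α j g) = P.α i g := by
    rw [← MulAut.mul_apply, ← map_mul, inv_mul_cancel_right]
  have h2 : (((Equiv.mulLeft (P.α i g)).trans (Equiv.mulRight (P.α j g)⁻¹)).trans
      (P.α m).toEquiv) u = P.α m (P.α i g * u * (P.α j g)⁻¹) := rfl
  rw [TensorProduct.star_tmul, star_cls, star_cls, h1, h2, ← map_inv (P.α m), ← map_mul (P.α m),
    SmashHopf.act_comm P.α j m, map_inv (P.α j)]
  congr 3
  group

lemma isCStarHopfAlgebra : IsCStarHopfAlgebra P.A where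
  comul_star u := by
    induction u using P.induction_cls with
    | h0 => simp
    | ha u v hu hv => simp only [star_add, map_add, hu, hv]
    | hs k u hu => rw [star_smul, map_smul, map_smul, hu, star_smul]
    | hb g i h m => exact P.comul_star_cls g h i m
  counit_star u := by
    induction u using P.induction_cls with
    | h0 => simp
    | ha u v hu hv => simp only [star_add, map_add, hu, hv]
    | hs k u hu => rw [star_smul, map_smul, map_smul, hu, star_smul]
    | hb g i h m =>
      rw [star_cls, counit_cls, counit_cls, apply_ite (star : ℂ → ℂ), star_one, star_zero]
      congr 1
      rw [eq_iff_iff, map_eq_one_iff _ (P.α m).injective]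
      refine and_congr_right ?_
      rintro rfl
      simp
  antipode_star u := by
    induction u using P.induction_cls with
    | h0 => simp
    | ha u v hu hv => simp only [star_add, map_add, hu, hv]
    | hs k u hu => simp only [star_smul, map_smul, hu, star_star]
    | hb g i h m =>
      simp only [star_cls, antipode_cls]
      have h1 : (P.α m).symm (P.α i (P.α m g)) = P.α i g := by
        rw [SmashHopf.act_comm P.α i m, MulEquiv.symm_apply_apply]
      have h2 : (P.α m).symm ((P.α i).symm (P.α m (P.α i g))) = g := by
        rw [SmashHopf.act_comm P.α m i, MulEquiv.symm_apply_apply, MulEquiv.symm_apply_apply]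
      simp [mul_assoc, h1, h2]
  semisimple := by
    have : IsArtinianRing P.A := IsArtinianRing.of_finite ℂ P.A
    obtain ⟨C, _, ⟨f⟩⟩ := P.exists_cstarAlgebra_equiv
    exact isSemisimpleRing_of_starAlgEquiv f
  cstar := P.exists_cstarAlgebra_equiv

/-! ### The presentation -/

section Presentation

/-- A relation of the presentation, read in the presented algebra. -/
lemma presented_rel {u v : FreeAlgebra ℂ P.Gen} (h : P.Rel u v) :
    RingQuot.mkAlgHom ℂ P.Rel u = RingQuot.mkAlgHom ℂ P.Rel v := RingQuot.mkAlgHom_rel ℂ h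

/-- The monomial `y ^ n z_i e_h x ^ m` of the presented algebra. -/
def monomial (n : ℕ) (i : ZMod P.q) (h : P.G) (m : ℕ) : P.Presented :=
  P.presentedGen .y ^ n * P.presentedGen (.z i) * P.presentedGen (.e h) * P.presentedGen .x ^ m

/-- The span of the monomials `y ^ n z_i e_h x ^ m`. -/
def monomialSpan : Submodule ℂ P.Presented :=
  Submodule.span ℂ (Set.range fun r : P.Idx =>
    P.monomial r.1.toAdd.val r.2.1.toAdd r.2.2.1 r.2.2.2.toAdd.val)

lemma presented_y_pow_mod (n : ℕ) :
    P.presentedGen .y ^ (n % P.p) = P.presentedGen .y ^ n := by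
  have h : P.presentedGen .y ^ P.p = 1 := by
    simpa [presentedGen] using P.presented_rel .y_pow
  exact (pow_eq_pow_mod n h).symm

lemma presented_x_pow_mod (n : ℕ) :
    P.presentedGen .x ^ (n % P.q) = P.presentedGen .x ^ n := by
  have h : P.presentedGen .x ^ P.q = 1 := by
    simpa [presentedGen] using P.presented_rel .x_pow
  exact (pow_eq_pow_mod n h).symm

lemma monomial_mem (n : ℕ) (i : ZMod P.q) (h : P.G) (m : ℕ) :
    P.monomial n i h m ∈ P.monomialSpan := by
  refine Submodule.subset_span ⟨(Multiplicative.ofAdd (n : ZMod P.p), Multiplicative.ofAdd i, h,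
    Multiplicative.ofAdd (m : ZMod P.q)), ?_⟩
  simp only [monomial, toAdd_ofAdd, ZMod.val_natCast, presented_y_pow_mod, presented_x_pow_mod]

lemma presented_y_pow_mul_x (n : ℕ) : P.presentedGen .y ^ n * P.presentedGen .x =
    P.presentedGen .x * P.presentedGen .y ^ (P.t * n) := by
  have h : P.presentedGen .y * P.presentedGen .x = P.presentedGen .x * P.presentedGen .y ^ P.t := by
    simpa [presentedGen] using P.presented_rel .y_x
  induction n with
  | zero => simp
  | succ n ih => rw [pow_succ, mul_assoc, h, ← mul_assoc, ih, mul_assoc, ← pow_add, mul_add_one]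

/-- As `t ^ q = 1` modulo `p`, the exponent `t ^ (q - 1)` inverts `t`. -/
lemma presented_x_mul_y_pow (n : ℕ) : P.presentedGen .x * P.presentedGen .y ^ n =
    P.presentedGen .y ^ (P.t ^ (P.q - 1) * n) * P.presentedGen .x := by
  rw [presented_y_pow_mul_x, ← mul_assoc, ← pow_succ', Nat.sub_add_cancel P.q_prime.one_le,
    ← presented_y_pow_mod P (_ * n), ← presented_y_pow_mod P n]
  congr 2
  have := P.t_pow.mul_right n
  rw [one_mul] at this
  exact this.symm

lemma presented_z_mul_y_pow (i : ZMod P.q) (n : ℕ) :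
    P.presentedGen (.z i) * P.presentedGen .y ^ n =
      P.presentedGen .y ^ n * P.presentedGen (.z i) := by
  have h : Commute (P.presentedGen (.z i)) (P.presentedGen .y) := by
    simpa [presentedGen, commute_iff_eq] using P.presented_rel (.z_y i)
  exact h.pow_right n

lemma presented_z_mul_z (i j : ZMod P.q) : P.presentedGen (.z i) * P.presentedGen (.z j) =
    if i = j then P.presentedGen (.z i) else 0 := by
  simpa [presentedGen, apply_ite (RingQuot.mkAlgHom ℂ P.Rel)] using P.presented_rel (.z_z i j)

lemma presented_e_mul_e (g h : P.G) : P.presentedGen (.e g) * P.presentedGen (.e h) =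
    if g = h then P.presentedGen (.e g) else 0 := by
  simpa [presentedGen, apply_ite (RingQuot.mkAlgHom ℂ P.Rel)] using P.presented_rel (.e_e g h)

lemma presented_e_mul_z (g : P.G) (i : ZMod P.q) :
    P.presentedGen (.e g) * P.presentedGen (.z i) =
      P.presentedGen (.z i) * P.presentedGen (.e g) := by
  simpa [presentedGen] using P.presented_rel (.e_z g i)

lemma presented_x_mul_z (i : ZMod P.q) : P.presentedGen .x * P.presentedGen (.z i) =
    P.presentedGen (.z i) * P.presentedGen .x := by
  simpa [presentedGen] using (P.presented_rel (.z_x i)).symm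

lemma presented_x_mul_e (g : P.G) : P.presentedGen .x * P.presentedGen (.e (P.ract g 1)) =
    P.presentedGen (.e g) * P.presentedGen .x := by
  simpa [presentedGen] using (P.presented_rel (.e_x g)).symm

lemma presented_e_mul_y_mul_z (g : P.G) (i : ZMod P.q) :
    P.presentedGen (.e g) * P.presentedGen .y * P.presentedGen (.z i) =
      P.presentedGen .y * P.presentedGen (.z i) *
        P.presentedGen (.e (P.ract P.a⁻¹ i * g * P.a)) := by
  have h : P.presentedGen (.e g) * P.presentedGen .y = P.presentedGen .y *
      ∑ j : ZMod P.q, P.presentedGen (.z j) * P.presentedGen (.e (P.ract P.a⁻¹ j * g * P.a)) := by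
    simpa [presentedGen] using P.presented_rel (.e_y g)
  simp only [h, mul_assoc, Finset.sum_mul, presented_e_mul_z]
  simp only [← mul_assoc (P.presentedGen (.z _)), presented_z_mul_z]
  simp

lemma presented_e_mul_y_pow_mul_z (g : P.G) (i : ZMod P.q) (n : ℕ) :
    ∃ h, P.presentedGen (.e g) * (P.presentedGen .y ^ n * P.presentedGen (.z i)) =
      P.presentedGen .y ^ n * P.presentedGen (.z i) * P.presentedGen (.e h) := by
  induction n with
  | zero => exact ⟨g, by simpa using P.presented_e_mul_z g i⟩
  | succ n ih =>
    obtain ⟨h, hh⟩ := ih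
    have hc : P.presentedGen (.z i) * P.presentedGen .y =
        P.presentedGen .y * P.presentedGen (.z i) := by
      simpa using P.presented_z_mul_y_pow i 1
    refine ⟨P.ract P.a⁻¹ i * h * P.a, ?_⟩
    calc P.presentedGen (.e g) * (P.presentedGen .y ^ (n + 1) * P.presentedGen (.z i))
        = P.presentedGen (.e g) * (P.presentedGen .y ^ n * P.presentedGen (.z i)) *
            P.presentedGen .y := by
          simp only [pow_succ, mul_assoc, hc]
      _ = P.presentedGen .y ^ n *
            (P.presentedGen (.e h) * P.presentedGen .y * P.presentedGen (.z i)) := by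
          rw [hh]
          simp only [mul_assoc, ← hc]
          rw [← mul_assoc (P.presentedGen (.e h)), ← mul_assoc (P.presentedGen (.z i)),
            presented_e_mul_z]
      _ = _ := by
          rw [presented_e_mul_y_mul_z, pow_succ]
          simp only [mul_assoc]

lemma gen_mul_monomial_mem (s : P.Gen) (n : ℕ) (i : ZMod P.q) (h : P.G) (m : ℕ) :
    P.presentedGen s * P.monomial n i h m ∈ P.monomialSpan := by
  cases s with
  | x =>
    have : P.presentedGen .x * P.monomial n i h m =
        P.monomial (P.t ^ (P.q - 1) * n) i ((P.α P.X)⁻¹ h) (m + 1) := by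
      have hh : h = P.ract ((P.α P.X)⁻¹ h) 1 := (MulAut.apply_inv_self P.G (P.α P.X) h).symm
      rw [monomial, ← mul_assoc, ← mul_assoc, ← mul_assoc, presented_x_mul_y_pow,
        mul_assoc _ (P.presentedGen .x), presented_x_mul_z, ← mul_assoc,
        mul_assoc _ (P.presentedGen .x)]
      conv_lhs => rw [hh]
      rw [presented_x_mul_e, monomial, pow_succ']
      simp only [mul_assoc]
    rw [this]
    exact P.monomial_mem _ _ _ _
  | y =>
    have : P.presentedGen .y * P.monomial n i h m = P.monomial (n + 1) i h m := by
      simp only [monomial, pow_succ', mul_assoc]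
    rw [this]
    exact P.monomial_mem _ _ _ _
  | z j =>
    have : P.presentedGen (.z j) * P.monomial n i h m =
        if j = i then P.monomial n i h m else 0 := by
      rw [monomial, ← mul_assoc, ← mul_assoc, ← mul_assoc, presented_z_mul_y_pow,
        mul_assoc (_ ^ n), presented_z_mul_z]
      split_ifs with hj
      · rw [hj]
      · simp
    rw [this]
    split_ifs
    · exact P.monomial_mem _ _ _ _
    · exact zero_mem _
  | e g =>
    obtain ⟨g', hg⟩ := P.presented_e_mul_y_pow_mul_z g i n
    have : P.presentedGen (.e g) * P.monomial n i h m =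
        if g' = h then P.monomial n i h m else 0 := by
      rw [monomial, ← mul_assoc, ← mul_assoc, hg, mul_assoc _ (P.presentedGen (.e g')),
        presented_e_mul_e]
      split_ifs with hj
      · rw [hj]
      · simp
    rw [this]
    split_ifs
    · exact P.monomial_mem _ _ _ _
    · exact zero_mem _

lemma one_mem_monomialSpan : (1 : P.Presented) ∈ P.monomialSpan := by
  have hz : ∑ i : ZMod P.q, P.presentedGen (.z i) = 1 := by
    simpa [presentedGen] using P.presented_rel .sum_z
  have he : ∑ g : P.G, P.presentedGen (.e g) = 1 := by
    simpa [presentedGen] using P.presented_rel .sum_e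
  rw [← one_mul (1 : P.Presented)]
  nth_rewrite 1 [← hz]
  rw [← he, Finset.sum_mul_sum]
  refine sum_mem fun i _ => sum_mem fun g _ => ?_
  simpa [monomial] using P.monomial_mem 0 i g 0

lemma monomialSpan_eq_top : P.monomialSpan = ⊤ := by
  have key : ∀ (w : FreeAlgebra ℂ P.Gen) (v : P.Presented), v ∈ P.monomialSpan →
      RingQuot.mkAlgHom ℂ P.Rel w * v ∈ P.monomialSpan := by
    intro w
    induction w using FreeAlgebra.induction with
    | grade0 r =>
      intro v hv
      rw [AlgHom.commutes, ← Algebra.smul_def]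
      exact Submodule.smul_mem _ _ hv
    | grade1 s =>
      intro v hv
      induction hv using Submodule.span_induction with
      | mem v hv =>
        obtain ⟨r, rfl⟩ := hv
        exact P.gen_mul_monomial_mem s _ _ _ _
      | zero => rw [mul_zero]; exact zero_mem _
      | add u v _ _ hu hv => rw [mul_add]; exact add_mem hu hv
      | smul k v _ hv => rw [mul_smul_comm]; exact Submodule.smul_mem _ _ hv
    | mul w w' hw hw' =>
      intro v hv
      rw [map_mul, mul_assoc]
      exact hw _ (hw' _ hv)
    | add w w' hw hw' =>
      intro v hv
      rw [map_add, add_mul]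
      exact add_mem (hw _ hv) (hw' _ hv)
  rw [eq_top_iff]
  intro u _
  obtain ⟨w, rfl⟩ := RingQuot.mkAlgHom_surjective ℂ P.Rel u
  simpa using key w 1 P.one_mem_monomialSpan

lemma lift_gen_rel {u v : FreeAlgebra ℂ P.Gen} (h : P.Rel u v) :
    FreeAlgebra.lift ℂ P.gen u = FreeAlgebra.lift ℂ P.gen v := by
  cases h with
  | y_x => simpa [free, gen] using P.y_mul_x
  | z_x i => simpa [free, gen] using P.z_mul_x i
  | e_x g => simpa [free, gen] using P.e_mul_x g
  | z_y i => simpa [free, gen] using P.z_mul_y i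
  | e_y g => simpa [free, gen] using P.e_mul_y g
  | e_z g i => simpa [free, gen] using P.e_mul_z g i
  | x_pow => simpa [free, gen] using P.x_pow_q
  | y_pow => simpa [free, gen] using P.y_pow_p
  | z_z i j => simpa [free, gen, apply_ite (FreeAlgebra.lift ℂ P.gen)] using P.z_mul_z i j
  | e_e g h => simpa [free, gen, apply_ite (FreeAlgebra.lift ℂ P.gen)] using P.e_mul_e g h
  | sum_z => simpa [free, gen] using P.sum_z
  | sum_e => simpa [free, gen] using P.sum_e

/-- The algebra map from the presented algebra to `A_{p,q}`. -/
def ofPresented : P.Presented →ₐ[ℂ] P.A :=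
  RingQuot.liftAlgHom ℂ ⟨FreeAlgebra.lift ℂ P.gen, fun _ _ h => P.lift_gen_rel h⟩

lemma ofPresented_gen (s : P.Gen) : P.ofPresented (P.presentedGen s) = P.gen s := by
  rw [ofPresented, presentedGen, RingQuot.liftAlgHom_mkAlgHom_apply, free, FreeAlgebra.lift_ι_apply]

lemma ofPresented_monomial (r : P.Idx) :
    P.ofPresented (P.monomial r.1.toAdd.val r.2.1.toAdd r.2.2.1 r.2.2.2.toAdd.val) =
      P.basisA r := by
  obtain ⟨l, i, h, m⟩ := r
  have hl : P.a ^ l.toAdd.val = SemidirectProduct.inl l := by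
    rw [a, ← map_pow, ← ofAdd_nsmul]; simp
  have hm : P.X ^ m.toAdd.val = m := by
    rw [X, ← ofAdd_nsmul]; simp
  simp only [monomial, map_mul, map_pow, ofPresented_gen, gen]
  refine P.ext_mul_cls fun g j k n => ?_
  rw [x_eq, xF_pow, y_eq, yG_pow, hl, hm, basisA_apply, clsIdx, cls_mul_cls]
  simp only [mul_assoc, xF_mul_cls, e_mul_cls, z_mul_cls, mul_ite, mul_zero, yG_mul_cls, ofAdd_toAdd]
  by_cases hi : i = j
  · subst hi
    simp
  · simp [hi]

lemma ofPresented_bijective : Function.Bijective P.ofPresented := by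
  let M : P.Idx → P.Presented := fun r =>
    P.monomial r.1.toAdd.val r.2.1.toAdd r.2.2.1 r.2.2.2.toAdd.val
  have hM : ∀ r, P.ofPresented (M r) = P.basisA r := P.ofPresented_monomial
  have hli : LinearIndependent ℂ M := by
    refine LinearIndependent.of_comp P.ofPresented.toLinearMap ?_
    have : P.ofPresented.toLinearMap ∘ M = P.basisA := funext hM
    rw [this]
    exact P.basisA.linearIndependent
  let bM : Basis P.Idx ℂ P.Presented := Basis.mk hli P.monomialSpan_eq_top.ge
  have heq : P.ofPresented.toLinearMap = (bM.equiv P.basisA (Equiv.refl _)).toLinearMap := by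
    refine bM.ext fun r => ?_
    rw [LinearEquiv.coe_coe, Basis.equiv_apply, Equiv.refl_apply]
    exact (congrArg P.ofPresented (Basis.mk_apply hli _ r)).trans (hM r)
  have : (P.ofPresented : P.Presented → P.A) = bM.equiv P.basisA (Equiv.refl _) :=
    funext fun u => LinearMap.congr_fun heq u
  rw [this]
  exact LinearEquiv.bijective _

end Presentation

/-! ### The Hopf structure on the generators -/

lemma comul_mkA_counit_e (g : P.G) (f : P.F) :
    comul (R := ℂ) (P.mkA counit (SmashHopf.e P.α g f)) = ∑ h : P.G,
      P.mkA counit (SmashHopf.e P.α h f) ⊗ₜ[ℂ] P.mkA counit (SmashHopf.e P.α (h⁻¹ * g) f) := by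
  have h1 : comul (R := ℂ) (counit : Dual ℂ P.A0) = counit ⊗ₜ[ℂ] counit := by
    refine CoopDual.ext_dualDistrib fun u v => ?_
    rw [CoopDual.dualDistrib_comul, TensorProduct.dualDistrib_apply, Bialgebra.counit_mul, mul_comm]
  rw [mkA, Bialgebra.Quotient.comul_mk, TensorProduct.comul_tmul, h1, SmashHopf.comul_e,
    TensorProduct.tmul_sum, map_sum, map_sum]
  rfl

lemma comul_dualCls (g : P.G) (f : P.F) : comul (R := ℂ) (P.dualCls g f) =
    ∑ j : P.F, P.dualCls (P.α j g) (f * j⁻¹) ⊗ₜ[ℂ] P.dualCls g j := by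
  rw [← mkA_E, mkA, Bialgebra.Quotient.comul_mk, TensorProduct.comul_tmul, SmashHopf.dualComul_E,
    Bialgebra.comul_one, Algebra.TensorProduct.one_def, TensorProduct.sum_tmul, map_sum, map_sum]
  simp only [← mkA_E]
  rfl

lemma comul_x : comul (R := ℂ) P.x = P.x ⊗ₜ[ℂ] P.x := by
  have h1 : P.x = ∑ g : P.G, P.mkA counit (SmashHopf.e P.α g P.X) := by
    rw [x, x0, mkA, TensorProduct.tmul_sum, mk_sum]
    rfl
  simp only [h1, map_sum, comul_mkA_counit_e, TensorProduct.sum_tmul, TensorProduct.tmul_sum]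
  rw [Finset.sum_comm]
  conv_rhs => rw [Finset.sum_comm]
  refine Finset.sum_congr rfl fun g _ => ?_
  exact Fintype.sum_equiv (Equiv.mulLeft g⁻¹) _ _ fun h => by simp

lemma comul_z (i : ZMod P.q) :
    comul (R := ℂ) (P.z i) = ∑ j : ZMod P.q, P.z j ⊗ₜ[ℂ] P.z (i - j) := by
  rw [z_eq, comul_dualCls]
  refine Fintype.sum_equiv (Multiplicative.toAdd.trans (Equiv.subLeft i)) _ _ fun j => ?_
  simp only [map_one, z_eq, Equiv.trans_apply, Equiv.subLeft_apply, sub_sub_cancel, ofAdd_toAdd,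
    ofAdd_sub, div_eq_mul_inv]

lemma comul_y : comul (R := ℂ) P.y =
    ∑ i : ZMod P.q, (P.y ^ P.t ^ i.val) ⊗ₜ[ℂ] (P.y * P.z i) := by
  rw [y_eq, yG_eq_sum, map_sum]
  simp only [comul_dualCls]
  rw [Finset.sum_comm]
  refine Fintype.sum_equiv Multiplicative.toAdd _ _ fun j => ?_
  rw [← TensorProduct.sum_tmul, ← yG_eq_sum, ← dualCls_eq, yG_pow, ← ract_a, yG_eq_sum]
  congr 1
  exact Fintype.sum_equiv (Equiv.mulRight j⁻¹) _ _ fun i => rfl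

lemma comul_e (g : P.G) :
    comul (R := ℂ) (P.e g) = ∑ h : P.G, P.e h ⊗ₜ[ℂ] P.e (h⁻¹ * g) := P.comul_mkA_counit_e g 1

lemma counit_dualCls (g : P.G) (f : P.F) :
    counit (R := ℂ) (P.dualCls g f) = if f = 1 then 1 else 0 := by
  simp only [dualCls, map_sum, counit_cls]
  by_cases hf : f = 1 <;> simp [hf]

lemma counit_x : counit (R := ℂ) P.x = 1 := by
  simp only [x_eq, xF, map_sum, counit_cls, ite_and]
  simp

lemma counit_y : counit (R := ℂ) P.y = 1 := by
  simp only [y_eq, yG_eq_sum, map_sum, counit_dualCls]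
  simp

lemma counit_z (i : ZMod P.q) : counit (R := ℂ) (P.z i) = if i = 0 then 1 else 0 := by
  rw [z_eq, counit_dualCls]
  simp only [ofAdd_eq_one]

lemma counit_e (g : P.G) : counit (R := ℂ) (P.e g) = if g = 1 then 1 else 0 := by
  simp only [e_eq, map_sum, counit_cls]
  by_cases hg : g = 1 <;> simp [hg]

lemma star_dualCls (g : P.G) (f : P.F) : star (P.dualCls g f) = P.dualCls g⁻¹ f := by
  rw [dualCls, star_sum]
  refine Fintype.sum_equiv ((Equiv.mulLeft (P.α f g)).trans (Equiv.mulRight g⁻¹)) _ _ fun h => ?_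
  simp [star_cls]

lemma star_x : star P.x = Ring.inverse P.x := by
  rw [inverse_x, x_eq, xF, star_sum]
  refine Finset.sum_congr rfl fun i _ => ?_
  rw [star_sum]
  exact Fintype.sum_equiv (P.α P.X).toEquiv _ _ fun h => by simp [star_cls]

lemma star_y : star P.y = Ring.inverse P.y := by
  rw [inverse_y, y_eq, yG_eq_sum, star_sum]
  simp only [star_dualCls]
  rfl

lemma star_z (i : ZMod P.q) : star (P.z i) = P.z i := by rw [z_eq, star_dualCls, inv_one]

lemma star_e (g : P.G) : star (P.e g) = P.e g := by simp [e_eq, star_sum, star_cls]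

lemma antipode_dualCls (g : P.G) (f : P.F) :
    antipode ℂ (P.dualCls g f) = P.dualCls (P.α f g)⁻¹ f⁻¹ := by
  rw [dualCls, map_sum]
  refine Fintype.sum_equiv (((Equiv.mulLeft (P.α f g)).trans (Equiv.mulRight g⁻¹)).trans
    (Equiv.inv P.G)) _ _ fun h => ?_
  simp [antipode_cls, mul_assoc]

lemma antipode_x : antipode ℂ P.x = Ring.inverse P.x := by
  rw [inverse_x, x_eq, xF, map_sum]
  refine Fintype.sum_equiv (Equiv.inv P.F) _ _ fun i => ?_
  rw [map_sum]
  exact Fintype.sum_equiv ((P.α P.X).toEquiv.trans (Equiv.inv P.G)) _ _ fun h => by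
    simp [antipode_cls]

lemma antipode_y : antipode ℂ P.y =
    ∑ i : ZMod P.q, Ring.inverse P.y ^ P.t ^ (-i).val * P.z i := by
  rw [inverse_y, y_eq, yG_eq_sum, map_sum]
  refine Fintype.sum_equiv (Multiplicative.toAdd.trans (Equiv.neg (ZMod P.q))) _ _ fun i => ?_
  have h1 : (Multiplicative.toAdd.trans (Equiv.neg (ZMod P.q))) i = -i.toAdd := rfl
  rw [antipode_dualCls, dualCls_eq, h1, neg_neg, yG_pow, inv_pow, ← ract_a]
  rfl

lemma antipode_z (i : ZMod P.q) : antipode ℂ (P.z i) = P.z (-i) := by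
  rw [z_eq, antipode_dualCls, z_eq, map_one, inv_one, ofAdd_neg]

lemma antipode_e (g : P.G) : antipode ℂ (P.e g) = P.e g⁻¹ := by
  rw [e_eq, e_eq, map_sum]
  exact Fintype.sum_equiv (Equiv.inv P.F) _ _ fun i => by simp [antipode_cls]

end Datum

end

theorem theorem4p6 (P : Datum) :
    IsCStarHopfAlgebra P.A ∧
    (∃ Φ : P.Presented ≃ₐ[ℂ] P.A, ∀ s : P.Gen, Φ (P.presentedGen s) = P.gen s) ∧
    (Coalgebra.comul (R := ℂ) P.x = P.x ⊗ₜ[ℂ] P.x ∧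
      Coalgebra.comul (R := ℂ) P.y = ∑ i : ZMod P.q, (P.y ^ P.t ^ i.val) ⊗ₜ[ℂ] (P.y * P.z i) ∧
      (∀ i : ZMod P.q,
        Coalgebra.comul (R := ℂ) (P.z i) = ∑ j : ZMod P.q, P.z j ⊗ₜ[ℂ] P.z (i - j)) ∧
      (∀ g : P.G, Coalgebra.comul (R := ℂ) (P.e g) = ∑ h : P.G, P.e h ⊗ₜ[ℂ] P.e (h⁻¹ * g))) ∧
    (Coalgebra.counit (R := ℂ) P.x = 1 ∧
      Coalgebra.counit (R := ℂ) P.y = 1 ∧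
      (∀ i : ZMod P.q, Coalgebra.counit (R := ℂ) (P.z i) = if i = 0 then 1 else 0) ∧
      (∀ g : P.G, Coalgebra.counit (R := ℂ) (P.e g) = if g = 1 then 1 else 0)) ∧
    (star P.x = Ring.inverse P.x ∧
      star P.y = Ring.inverse P.y ∧
      (∀ i : ZMod P.q, star (P.z i) = P.z i) ∧
      (∀ g : P.G, star (P.e g) = P.e g)) ∧
    (HopfAlgebra.antipode ℂ P.x = Ring.inverse P.x ∧
      HopfAlgebra.antipode ℂ P.y =
        ∑ i : ZMod P.q, Ring.inverse P.y ^ P.t ^ (-i).val * P.z i ∧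
      (∀ i : ZMod P.q, HopfAlgebra.antipode ℂ (P.z i) = P.z (-i)) ∧
      (∀ g : P.G, HopfAlgebra.antipode ℂ (P.e g) = P.e g⁻¹)) := by
  refine ⟨P.isCStarHopfAlgebra,
    ⟨AlgEquiv.ofBijective P.ofPresented P.ofPresented_bijective, P.ofPresented_gen⟩,
    ⟨P.comul_x, P.comul_y, P.comul_z, P.comul_e⟩,
    ⟨P.counit_x, P.counit_y, P.counit_z, P.counit_e⟩,
    ⟨P.star_x, P.star_y, P.star_z, P.star_e⟩,
    ⟨P.antipode_x, P.antipode_y, P.antipode_z, P.antipode_e⟩⟩
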